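/- **Maliciousness detectability of the Gaussian two-way relay network.** *Channel.* Let $\sigma^2>0$. For each block length $n$ let $X_1^n,X_2^n$ be sequences of equiprobable $\pm1$ symbols and $N^n$ a sequence of $\mathcal N(0,\sigma^2)$ variables, all $3n$ variables independent. The relay receives $U_i=X_{1,i}+X_{2,i}+N_i$ and forwards $V^n$ drawn from an arbitrary conditional law given $U^n$ (an *attack*, that is, a Markov kernel $\kappa_n$ from $\mathbb R^n$ to $\mathbb R^n$; the $V_i$ need not be independent or identically distributed). Source 1 observes $V^n$ without noise. For $a=\pm1$ let $F_{U|a}(t)=\int_{-\infty}^t f_{U|a}(u)\,du$, where $f_{U|a}$ is the equal mixture of the $\mathcal N(a+1,\sigma^2)$ and $\mathcal N(a-1,\sigma^2)$ densities. *Quantization.* For each $n'$ let $\alpha<\beta<\tilde u_{n'}$ (all depending on $n'$) be such that, as $n'\to\infty$, $F_{U|a}(\alpha)\to0$, $F_{U|a}(\beta)\to1$ for $a=\pm1$ and $\frac{\beta-\alpha}{n'-2}\to0$. Put $\tilde u_j=\alpha+(j-1)\frac{\beta-\alpha}{n'-2}$ for $1\le j\le n'-1$, and $\mathcal B_1=(-\infty,\alpha]$,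 $\mathcal B_j=(\tilde u_{j-1},\tilde u_j]$ for $2\le j\le n'-1$, $\mathcal B_{n'}=(\beta,\infty)$. Let $F^{(n')}(t|\tilde u_i)$ be the fraction of the indices $k$ with $U_k\in\mathcal B_i$ for which $V_k\le t$ (and $0$ if there is no such $k$), let $\Phi(t)=1$ for $t\ge0$ and $\Phi(t)=0$ for $t<0$, and let $$R=\sum_{j=1}^{n'-1}\sum_{i=1}^{n'}\bigl|F^{(n')}(\tilde u_j|\tilde u_i)-\Phi(\tilde u_j-\tilde u_i)\bigr| .$$ *Statistic.* Let $F^n(t|a)$ be the fraction of the indices $k$ with $X_{1,k}=a$ for which $V_k\le t$, and let $$D^n=\max_{a\in\{1,-1\}}\ \frac1{n'-2}\sum_{j=1}^{n'-1}\bigl|F^n(\tilde u_j|a)-F_{U|a}(\tilde u_j)\bigr| .$$ *Claim.* There are thresholds $\varepsilon(n',\delta)>0$ and $\mu'(n',\delta)$, with $\mu'(n',\delta)\to0$ as $n'\to\infty$ and $\delta\to0^+$, such that for all $\delta>0$ and $\epsilon>0$, for all sufficiently large $n'$, for every sequence of attacks $(\kappa_n)$ and every $c>0$: 1. for every $\theta\in(0,\varepsilon(n',\delta)]$,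 for all sufficiently large $n$, if $\Pr(R>\delta)\ge c$ then $\Pr(D^n>\theta\mid R>\delta)\ge1-\epsilon$; 2. for all sufficiently large $n$, if $\Pr(R\le\delta)\ge c$ then $\Pr(D^n>\mu'(n',\delta)\mid R\le\delta)\le\epsilon$. -/

import Mathlib

open MeasureTheory ProbabilityTheory Filter Topology Set
open scoped NNReal ENNReal

namespace TwoWayRelay

noncomputable section

/-! ### The multiple-access channel `U = X₁ + X₂ + N_r` -/

/-- Law of one equiprobable binary source symbol with alphabet `{+1, -1}`. -/
def symbolLaw : Measure ℝ :=
  (2⁻¹ : ℝ≥0∞) • Measure.dirac (1 : ℝ) + (2⁻¹ : ℝ≥0∞) • Measure.dirac (-1 : ℝ)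

/-- Outcomes of the first `n` instants: the source sequences `x₁ⁿ`, `x₂ⁿ` and the noise at the
relay, in this order. -/
abbrev Source (n : ℕ) : Type := (Fin n → ℝ) × (Fin n → ℝ) × (Fin n → ℝ)

/-- Joint law of `(X₁ⁿ, X₂ⁿ, N_rⁿ)`: all `3 n` variables are independent, the symbols are
equiprobable signs and the noise is centred Gaussian with variance `σsq`. -/
def sourceLaw (σsq : ℝ≥0) (n : ℕ) : Measure (Source n) :=
  (Measure.pi fun _ : Fin n => symbolLaw).prod
    ((Measure.pi fun _ : Fin n => symbolLaw).prod
      (Measure.pi fun _ : Fin n => gaussianReal 0 σsq))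

/-- The sequence `uⁿ = x₁ⁿ + x₂ⁿ + n_rⁿ` received by the relay. -/
def relayInput {n : ℕ} (s : Source n) : Fin n → ℝ :=
  fun i => s.1 i + s.2.1 i + s.2.2 i

theorem measurable_relayInput {n : ℕ} : Measurable (relayInput (n := n)) := by
  unfold relayInput
  fun_prop

/-- Joint law of sources, noise and forwarded sequence `Vⁿ`, when a relay that has received the
whole block `uⁿ` draws `Vⁿ` from `κ uⁿ`. The Markov kernel `κ` is arbitrary: the forwarded symbols
may depend on each other and on the whole block, in any way. -/
def systemLaw (σsq : ℝ≥0) {n : ℕ} (κ : Kernel (Fin n → ℝ) (Fin n → ℝ)) :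
    Measure (Source n × (Fin n → ℝ)) :=
  (sourceLaw σsq n) ⊗ₘ (κ.comap relayInput measurable_relayInput)

/-- The density `f_{U|x₁}` of `U = x₁ + X₂ + N_r`. -/
def relayPDF (σsq : ℝ≥0) (x₁ u : ℝ) : ℝ :=
  2⁻¹ * gaussianPDFReal (x₁ + 1) σsq u + 2⁻¹ * gaussianPDFReal (x₁ - 1) σsq u

/-- The distribution function `F_{U|x₁}`. -/
def relayCDF (σsq : ℝ≥0) (x₁ t : ℝ) : ℝ :=
  ∫ u in Iic t, relayPDF σsq x₁ u

/-! ### Quantization -/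

/-- End points `α < β` of the quantized range and the representative `γ > β` of the last cell. -/
structure QuantGrid where
  α : ℝ
  β : ℝ
  γ : ℝ
  α_lt_β : α < β
  β_lt_γ : β < γ

/-- The points `ũ₁ = α < ũ₂ < ⋯ < ũ_{m-1} = β < ũ_m = γ`, the first `m - 1` of them equally
spaced with step `(β - α) / (m - 2)`. -/
def QuantGrid.point (G : QuantGrid) (m j : ℕ) : ℝ :=
  if j = m then G.γ else G.α + ((j : ℝ) - 1) * ((G.β - G.α) / ((m : ℝ) - 2))

/-- The cells `B(ũ₁) = (-∞, α]`, `B(ũ_j) = (ũ_{j-1}, ũ_j]`, `B(ũ_m) = (β, ∞)`. The quantized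
variable `Ũ` equals `ũ_j` exactly when `U ∈ B(ũ_j)`. -/
def QuantGrid.cell (G : QuantGrid) (m j : ℕ) : Set ℝ :=
  if j = 1 then Iic G.α
  else if j = m then Ioi G.β
  else Ioc (G.point m (j - 1)) (G.point m j)

/-- The grids, indexed by the number `m` of cells, exhaust the line in probability and their
step vanishes. -/
def IsAdmissible (σsq : ℝ≥0) (G : ℕ → QuantGrid) : Prop :=
  (∀ x₁ ∈ ({1, -1} : Set ℝ),
    Tendsto (fun m => relayCDF σsq x₁ (G m).α) atTop (𝓝 0) ∧
    Tendsto (fun m => relayCDF σsq x₁ (G m).β) atTop (𝓝 1)) ∧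
  Tendsto (fun m : ℕ => ((G m).β - (G m).α) / ((m : ℝ) - 2)) atTop (𝓝 0)

/-! ### Empirical distribution functions, attack measure and decision statistic -/

/-- The unit step. -/
def unitStep (t : ℝ) : ℝ := if 0 ≤ t then 1 else 0

open Classical in
/-- Empirical distribution function of `vⁿ` at `t` conditioned on the quantized `ũⁿ` being equal
to `ũ_j`; it is `0` if `ũ_j` does not occur in `ũⁿ`. -/
def quantEmpCDF (G : QuantGrid) (m : ℕ) {n : ℕ} (u v : Fin n → ℝ) (t : ℝ) (j : ℕ) : ℝ :=
  ((Finset.univ.filter fun i => v i ≤ t ∧ u i ∈ G.cell m j).card : ℝ) /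
    ((Finset.univ.filter fun i => u i ∈ G.cell m j).card : ℝ)

/-- The attack measure `R`: total deviation of the quantized empirical conditional distribution
functions from the unit step. -/
def attackMeasure (G : QuantGrid) (m : ℕ) {n : ℕ} (u v : Fin n → ℝ) : ℝ :=
  ∑ j ∈ Finset.Icc 1 (m - 1), ∑ i ∈ Finset.Icc 1 m,
    |quantEmpCDF G m u v (G.point m j) i - unitStep (G.point m j - G.point m i)|

open Classical in
/-- Empirical distribution function of `vⁿ` at `t` conditioned on the own symbol being `a`. -/
def condEmpCDF {n : ℕ} (x v : Fin n → ℝ) (t a : ℝ) : ℝ :=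
  ((Finset.univ.filter fun i => v i ≤ t ∧ x i = a).card : ℝ) /
    ((Finset.univ.filter fun i => x i = a).card : ℝ)

/-- The statistic for one value `a` of the own symbol, with test points `t_j = ũ_j`. -/
def symbolStat (σsq : ℝ≥0) (G : QuantGrid) (m : ℕ) {n : ℕ} (x v : Fin n → ℝ) (a : ℝ) : ℝ :=
  1 / ((m : ℝ) - 2) * ∑ j ∈ Finset.Icc 1 (m - 1),
    |condEmpCDF x v (G.point m j) a - relayCDF σsq a (G.point m j)|

/-- The decision statistic `Dⁿ` of source 1, computed from its own symbols `xⁿ = x₁ⁿ` and its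
observation `vⁿ` only: the larger one of the statistics for the two values of the own symbol. -/
def decisionStat (σsq : ℝ≥0) (G : QuantGrid) (m : ℕ) {n : ℕ} (x v : Fin n → ℝ) : ℝ :=
  max (symbolStat σsq G m x v 1) (symbolStat σsq G m x v (-1))

/-- The event `R > δ`. -/
def attackedEvent (G : QuantGrid) (m n : ℕ) (δ : ℝ) : Set (Source n × (Fin n → ℝ)) :=
  {ω | δ < attackMeasure G m (relayInput ω.1) ω.2}

/-- The event `R ≤ δ`. -/
def unattackedEvent (G : QuantGrid) (m n : ℕ) (δ : ℝ) : Set (Source n × (Fin n → ℝ)) :=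
  {ω | attackMeasure G m (relayInput ω.1) ω.2 ≤ δ}

/-- The event `Dⁿ > θ`. -/
def alarmEvent (σsq : ℝ≥0) (G : QuantGrid) (m n : ℕ) (θ : ℝ) : Set (Source n × (Fin n → ℝ)) :=
  {ω | θ < decisionStat σsq G m ω.1.1 ω.2}

end

end TwoWayRelay

open TwoWayRelay

namespace TwoWayRelay

noncomputable section

/-! ### The law of one own symbol together with the received value -/

/-! For a grid point `t` let `d_k = 1{V_k ≤ t} - 1{U_k ≤ t}` (`stepDiff`). Both claims compare `R`
and `Dⁿ` with the averages of `|d_k|` at the grid points.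

Small `R`: each cell lies on one side of `t`, so the `d_k` of one cell share a sign and the average
of `|d_k|` is at most `R`. Replacing `V` by `U` therefore changes the conditional empirical
distribution functions little, and for `U` the weak law gives `F_{U|a}`. This yields the threshold
`12 δ`.

Small `Dⁿ`: the attack sees only `Uⁿ`, so given `Uⁿ` the block `Vⁿ` is independent of `X₁ⁿ`. Hence
the variables `1{V_k ≤ t} (1{X_{1,k} = a} - p_a(U_k))`, with `p_a` the posterior of the symbol, are
orthogonal for every attack, and their average tends to zero (`negligible_weighted_average`). So a
small `Dⁿ` makes the averages of `d_k p_a(U_k)` small for both `a`, and with them the average of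
`d_k (p_1(U_k) - p_1(t))`. The Gaussian mixtures have a monotone likelihood ratio, so `p_1` is
strictly increasing. Since `d_k ≤ 0` for `U_k ≤ t` and `d_k ≥ 0` for `U_k > t`, all these summands
are nonnegative and nothing cancels (`sum_abs_stepDiff_mul_le`). As `U` has no atom, `p_1(U_k)` is
rarely near `p_1(t)`, so the average of `|d_k|` is small. Every cell has positive probability, which
turns this into `R ≤ δ` (`attackMeasure_le`). -/

instance : IsProbabilityMeasure symbolLaw where
  measure_univ := by simp [symbolLaw, ENNReal.inv_two_add_inv_two]

/-- The conditional law of `U` given `X₁ = a`. -/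
def relayLaw (σsq : ℝ≥0) (a : ℝ) : Measure ℝ :=
  (2⁻¹ : ℝ≥0∞) • gaussianReal (a + 1) σsq + (2⁻¹ : ℝ≥0∞) • gaussianReal (a - 1) σsq

instance (σsq : ℝ≥0) (a : ℝ) : IsProbabilityMeasure (relayLaw σsq a) where
  measure_univ := by simp [relayLaw, ENNReal.inv_two_add_inv_two]

/-- The joint law of `(X₁, U)` at one instant. -/
def sampleLaw (σsq : ℝ≥0) : Measure (ℝ × ℝ) :=
  (2⁻¹ : ℝ≥0∞) • (relayLaw σsq 1).map (Prod.mk 1) +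
    (2⁻¹ : ℝ≥0∞) • (relayLaw σsq (-1)).map (Prod.mk (-1))

instance (σsq : ℝ≥0) : IsProbabilityMeasure (sampleLaw σsq) where
  measure_univ := by
    simp [sampleLaw, Measure.map_apply measurable_prodMk_left, ENNReal.inv_two_add_inv_two]

theorem lintegral_symbolLaw {g : ℝ → ℝ≥0∞} (hg : Measurable g) :
    ∫⁻ x, g x ∂symbolLaw = 2⁻¹ * g 1 + 2⁻¹ * g (-1) := by
  simp [symbolLaw, lintegral_add_measure, lintegral_smul_measure, lintegral_dirac' _ hg]

theorem lintegral_gaussianReal_const_add (σsq : ℝ≥0) (c : ℝ) {g : ℝ → ℝ≥0∞} (hg : Measurable g) :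
    ∫⁻ z, g (c + z) ∂(gaussianReal 0 σsq) = ∫⁻ u, g u ∂(gaussianReal c σsq) := by
  have h := gaussianReal_map_const_add (μ := 0) (v := σsq) c
  rw [zero_add] at h
  rw [← h, lintegral_map hg (by fun_prop)]

theorem map_sample (σsq : ℝ≥0) :
    (symbolLaw.prod (symbolLaw.prod (gaussianReal 0 σsq))).map
      (fun w : ℝ × ℝ × ℝ => (w.1, w.1 + w.2.1 + w.2.2)) = sampleLaw σsq := by
  refine Measure.ext_of_lintegral _ fun g hg => ?_
  rw [lintegral_map hg (by fun_prop), lintegral_prod _ (by fun_prop)]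
  have h1 : ∀ x : ℝ, ∫⁻ w, g (x, x + w.1 + w.2) ∂(symbolLaw.prod (gaussianReal 0 σsq)) =
      ∫⁻ u, g (x, u) ∂(relayLaw σsq x) := by
    intro x
    rw [lintegral_prod _ (by fun_prop)]
    have h2 : ∀ y : ℝ, ∫⁻ z, g (x, x + y + z) ∂(gaussianReal 0 σsq) =
        ∫⁻ u, g (x, u) ∂(gaussianReal (x + y) σsq) := fun y =>
      lintegral_gaussianReal_const_add σsq (x + y) (g := fun u => g (x, u)) (by fun_prop)
    have hm : Measurable fun y : ℝ => ∫⁻ z, g (x, x + y + z) ∂(gaussianReal 0 σsq) :=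
      Measurable.lintegral_prod_right' (f := fun p : ℝ × ℝ => g (x, x + p.1 + p.2)) (by fun_prop)
    rw [lintegral_symbolLaw hm, h2, h2]
    simp [relayLaw, lintegral_add_measure, lintegral_smul_measure, sub_eq_add_neg]
  have hm : Measurable fun x : ℝ =>
      ∫⁻ w, g (x, x + w.1 + w.2) ∂(symbolLaw.prod (gaussianReal 0 σsq)) :=
    Measurable.lintegral_prod_right'
      (f := fun p : ℝ × ℝ × ℝ => g (p.1, p.1 + p.2.1 + p.2.2)) (by fun_prop)
  rw [lintegral_symbolLaw hm, h1, h1, sampleLaw, lintegral_add_measure, lintegral_smul_measure,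
    lintegral_smul_measure, lintegral_map hg measurable_prodMk_left,
    lintegral_map hg measurable_prodMk_left]
  rfl

/-- The sequence of pairs `(X₁ₖ, Uₖ)`. -/
def samples {n : ℕ} (s : Source n) : Fin n → ℝ × ℝ := fun k => (s.1 k, relayInput s k)

theorem measurable_samples {n : ℕ} : Measurable (samples (n := n)) := by
  unfold samples relayInput
  fun_prop

theorem map_samples (σsq : ℝ≥0) (n : ℕ) :
    (sourceLaw σsq n).map samples = Measure.pi fun _ : Fin n => sampleLaw σsq := by
  -- Zip the three independent sequences into one i.i.d. sequence of triples; the map of a single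
  -- instant then acts coordinatewise.
  have h1 := (measurePreserving_arrowProdEquivProdArrow ℝ ℝ (Fin n) (fun _ => symbolLaw)
    (fun _ => gaussianReal 0 σsq)).symm
  have h2 := (measurePreserving_arrowProdEquivProdArrow ℝ (ℝ × ℝ) (Fin n) (fun _ => symbolLaw)
    (fun _ => symbolLaw.prod (gaussianReal 0 σsq))).symm
  have h3 := h2.comp ((MeasurePreserving.id (Measure.pi fun _ : Fin n => symbolLaw)).prod h1)
  have h4 : sampleLaw σsq = (symbolLaw.prod (symbolLaw.prod (gaussianReal 0 σsq))).map
      (fun w : ℝ × ℝ × ℝ => (w.1, w.1 + w.2.1 + w.2.2)) := (map_sample σsq).symm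
  have : ∀ _ : Fin n, SigmaFinite ((symbolLaw.prod (symbolLaw.prod (gaussianReal 0 σsq))).map
      (fun w : ℝ × ℝ × ℝ => (w.1, w.1 + w.2.1 + w.2.2))) := fun _ => by
    rw [← h4]; infer_instance
  simp_rw [h4]
  rw [← Measure.pi_map_pi (fun _ => by fun_prop), ← h3.map_eq, Measure.map_map (by fun_prop)
    h3.measurable]
  rfl

theorem isProbabilityMeasure_sourceLaw (σsq : ℝ≥0) (n : ℕ) :
    IsProbabilityMeasure (sourceLaw σsq n) := by
  unfold sourceLaw; infer_instance

theorem integral_sampleLaw (σsq : ℝ≥0) {g : ℝ × ℝ → ℝ} (hg : Measurable g) {C : ℝ}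
    (hC : ∀ p, |g p| ≤ C) :
    ∫ p, g p ∂(sampleLaw σsq) =
      2⁻¹ * ∫ u, g (1, u) ∂(relayLaw σsq 1) + 2⁻¹ * ∫ u, g (-1, u) ∂(relayLaw σsq (-1)) := by
  have hi : ∀ a : ℝ, Integrable g ((relayLaw σsq a).map (Prod.mk a)) := fun a =>
    have := Measure.isProbabilityMeasure_map (μ := relayLaw σsq a) (f := Prod.mk a)
      measurable_prodMk_left.aemeasurable
    Integrable.of_bound hg.aestronglyMeasurable C (ae_of_all _ hC)
  rw [sampleLaw, integral_add_measure ((hi 1).smul_measure (by simp))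
    ((hi (-1)).smul_measure (by simp)), integral_smul_measure, integral_smul_measure,
    integral_map measurable_prodMk_left.aemeasurable hg.aestronglyMeasurable,
    integral_map measurable_prodMk_left.aemeasurable hg.aestronglyMeasurable]
  simp

theorem measurable_relayPDF (σsq : ℝ≥0) (a : ℝ) : Measurable (relayPDF σsq a) := by
  unfold relayPDF
  have h1 := measurable_gaussianPDFReal (a + 1) σsq
  have h2 := measurable_gaussianPDFReal (a - 1) σsq
  fun_prop

theorem relayPDF_pos {σsq : ℝ≥0} (hσ : σsq ≠ 0) (a u : ℝ) : 0 < relayPDF σsq a u := by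
  have h1 := gaussianPDFReal_pos (a + 1) σsq u hσ
  have h2 := gaussianPDFReal_pos (a - 1) σsq u hσ
  unfold relayPDF
  positivity

theorem integral_relayLaw {σsq : ℝ≥0} (hσ : σsq ≠ 0) (a : ℝ) {g : ℝ → ℝ} (hg : Measurable g)
    {C : ℝ} (hC : ∀ u, |g u| ≤ C) :
    ∫ u, g u ∂(relayLaw σsq a) = ∫ u, relayPDF σsq a u * g u := by
  have hi : ∀ b : ℝ, Integrable g (gaussianReal b σsq) := fun b =>
    Integrable.of_bound hg.aestronglyMeasurable C (ae_of_all _ hC)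
  have hj : ∀ b : ℝ, Integrable (fun u => 2⁻¹ * gaussianPDFReal b σsq u * g u) := fun b =>
    ((integrable_gaussianPDFReal b σsq).const_mul 2⁻¹).mul_bdd hg.aestronglyMeasurable
      (ae_of_all _ hC)
  rw [relayLaw, integral_add_measure ((hi _).smul_measure (by simp))
    ((hi _).smul_measure (by simp)), integral_smul_measure, integral_smul_measure,
    integral_gaussianReal_eq_integral_smul hσ, integral_gaussianReal_eq_integral_smul hσ]
  simp_rw [relayPDF, add_mul]
  rw [integral_add (hj _) (hj _)]
  simp_rw [mul_assoc, integral_const_mul]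
  simp

theorem relayCDF_eq {σsq : ℝ≥0} (hσ : σsq ≠ 0) (a t : ℝ) :
    relayCDF σsq a t = (relayLaw σsq a).real (Iic t) := by
  have h := integral_relayLaw hσ a (g := (Iic t).indicator 1) (C := 1)
    (measurable_one.indicator measurableSet_Iic) (fun u => by
      by_cases hu : u ∈ Iic t <;> simp [hu])
  rw [integral_indicator_one measurableSet_Iic] at h
  rw [h, relayCDF, ← integral_indicator measurableSet_Iic]
  congr 1 with u
  by_cases hu : u ∈ Iic t <;> simp [hu]

theorem relayCDF_nonneg {σsq : ℝ≥0} (hσ : σsq ≠ 0) (a t : ℝ) : 0 ≤ relayCDF σsq a t := by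
  rw [relayCDF_eq hσ]; exact measureReal_nonneg

theorem relayCDF_le_one {σsq : ℝ≥0} (hσ : σsq ≠ 0) (a t : ℝ) : relayCDF σsq a t ≤ 1 := by
  rw [relayCDF_eq hσ]; exact measureReal_le_one

theorem sampleLaw_apply (σsq : ℝ≥0) {S : Set (ℝ × ℝ)} (hS : MeasurableSet S) :
    sampleLaw σsq S = 2⁻¹ * relayLaw σsq 1 (Prod.mk 1 ⁻¹' S) +
      2⁻¹ * relayLaw σsq (-1) (Prod.mk (-1) ⁻¹' S) := by
  simp [sampleLaw, Measure.map_apply measurable_prodMk_left hS]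

theorem sampleLaw_real_symbol_eq (σsq : ℝ≥0) {a : ℝ} (ha : a = 1 ∨ a = -1) :
    (sampleLaw σsq).real {p | p.1 = a} = 1 / 2 := by
  have hS : MeasurableSet {p : ℝ × ℝ | p.1 = a} :=
    measurableSet_eq_fun measurable_fst measurable_const
  rcases ha with rfl | rfl <;> simp [measureReal_def, sampleLaw_apply _ hS] <;> norm_num

theorem sampleLaw_real_symbol_eq_inter_Iic {σsq : ℝ≥0} (hσ : σsq ≠ 0) {a : ℝ}
    (ha : a = 1 ∨ a = -1) (t : ℝ) :
    (sampleLaw σsq).real {p | p.2 ≤ t ∧ p.1 = a} = relayCDF σsq a t / 2 := by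
  have hS : MeasurableSet {p : ℝ × ℝ | p.2 ≤ t ∧ p.1 = a} :=
    (measurableSet_le measurable_snd measurable_const).inter
      (measurableSet_eq_fun measurable_fst measurable_const)
  have h0 : ¬ (1 : ℝ) = -1 := by norm_num
  have h0' : ¬ (-1 : ℝ) = 1 := by norm_num
  rcases ha with rfl | rfl
  · rw [relayCDF_eq hσ, measureReal_def, sampleLaw_apply _ hS]
    simp [h0', measureReal_def, Iic_def]
    ring
  · rw [relayCDF_eq hσ, measureReal_def, sampleLaw_apply _ hS]
    simp [h0, measureReal_def, Iic_def]
    ring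

theorem sampleLaw_real_preimage_snd_pos {σsq : ℝ≥0} (hσ : σsq ≠ 0) {B : Set ℝ}
    (hB : MeasurableSet B) (h0 : volume B ≠ 0) : 0 < (sampleLaw σsq).real (Prod.snd ⁻¹' B) := by
  rw [measureReal_def]
  refine ENNReal.toReal_pos ?_ (measure_ne_top _ _)
  rw [sampleLaw_apply _ (measurable_snd hB)]
  have : gaussianReal (1 + 1) σsq B ≠ 0 := fun h =>
    h0 (gaussianReal_absolutelyContinuous' (1 + 1) hσ h)
  simp [relayLaw, this, ← Set.preimage_comp, Function.comp_def]

theorem sampleLaw_snd_singleton {σsq : ℝ≥0} (hσ : σsq ≠ 0) (t : ℝ) :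
    sampleLaw σsq (Prod.snd ⁻¹' {t}) = 0 := by
  have h : ∀ b : ℝ, gaussianReal b σsq {t} = 0 := fun b =>
    gaussianReal_absolutelyContinuous b hσ Real.volume_singleton
  rw [sampleLaw_apply _ (measurable_snd (measurableSet_singleton t))]
  simp [relayLaw, h, ← Set.preimage_comp, Function.comp_def]

/-! ### The posterior law of the own symbol given the received value -/

/-- The conditional probability of `X₁ = a` given `U = u`. -/
def posterior (σsq : ℝ≥0) (a u : ℝ) : ℝ :=
  relayPDF σsq a u / (relayPDF σsq 1 u + relayPDF σsq (-1) u)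

theorem measurable_posterior (σsq : ℝ≥0) (a : ℝ) : Measurable (posterior σsq a) :=
  (measurable_relayPDF _ _).div ((measurable_relayPDF _ _).add (measurable_relayPDF _ _))

theorem posterior_nonneg {σsq : ℝ≥0} (hσ : σsq ≠ 0) (a u : ℝ) : 0 ≤ posterior σsq a u :=
  div_nonneg (relayPDF_pos hσ a u).le
    (add_pos (relayPDF_pos hσ 1 u) (relayPDF_pos hσ (-1) u)).le

theorem posterior_add {σsq : ℝ≥0} (hσ : σsq ≠ 0) (u : ℝ) :
    posterior σsq 1 u + posterior σsq (-1) u = 1 := by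
  rw [posterior, posterior, ← add_div,
    div_self (add_pos (relayPDF_pos hσ 1 u) (relayPDF_pos hσ (-1) u)).ne']

theorem posterior_le_one {σsq : ℝ≥0} (hσ : σsq ≠ 0) {a : ℝ} (ha : a = 1 ∨ a = -1) (u : ℝ) :
    posterior σsq a u ≤ 1 := by
  have h := posterior_add hσ u
  have h1 := posterior_nonneg hσ 1 u
  have h2 := posterior_nonneg hσ (-1) u
  rcases ha with rfl | rfl <;> linarith

/-- Expand the square in the exponent. Both means `±2` give the same factor `exp (-2 / σsq)`, which
keeps the two mixtures comparable. -/
theorem gaussianPDFReal_two (σsq : ℝ≥0) (e u : ℝ) (he : e * e = 4) :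
    gaussianPDFReal e σsq u =
      gaussianPDFReal 0 σsq u * (Real.exp (-2 / σsq) * Real.exp (e * u / σsq)) := by
  rw [gaussianPDFReal, gaussianPDFReal, ← Real.exp_add, mul_assoc (√_)⁻¹, ← Real.exp_add]
  congr 2
  rcases eq_or_ne σsq 0 with rfl | h
  · simp
  · have : (σsq : ℝ) ≠ 0 := by exact_mod_cast h
    field_simp
    linear_combination -he

/-- Strictly monotone likelihood ratio. With the centred Gaussian density factored out, the density
for the symbol `1` becomes increasing, `1 + c exp (2u/σ²)`, and the one for `-1` decreasing, `1 + c
exp (-2u/σ²)`. -/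
theorem relayPDF_mul_lt {σsq : ℝ≥0} (hσ : σsq ≠ 0) {u t : ℝ} (hut : u < t) :
    relayPDF σsq 1 u * relayPDF σsq (-1) t < relayPDF σsq 1 t * relayPDF σsq (-1) u := by
  have hs : (0 : ℝ) < σsq := by positivity
  have e1 : ∀ w, relayPDF σsq 1 w = 2⁻¹ * gaussianPDFReal 0 σsq w *
      (Real.exp (-2 / σsq) * Real.exp (2 * w / σsq) + 1) := fun w => by
    rw [relayPDF, show (1 : ℝ) + 1 = 2 by norm_num, sub_self,
      gaussianPDFReal_two σsq 2 w (by norm_num)]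
    ring
  have e2 : ∀ w, relayPDF σsq (-1) w = 2⁻¹ * gaussianPDFReal 0 σsq w *
      (1 + Real.exp (-2 / σsq) * Real.exp (-2 * w / σsq)) := fun w => by
    rw [relayPDF, neg_add_cancel, show (-1 : ℝ) - 1 = -2 by norm_num,
      gaussianPDFReal_two σsq (-2) w (by norm_num)]
    ring
  rw [e1, e1, e2, e2]
  have gu := gaussianPDFReal_pos 0 σsq u hσ
  have gt := gaussianPDFReal_pos 0 σsq t hσ
  have hp : Real.exp (2 * u / σsq) < Real.exp (2 * t / σsq) := by gcongr
  have hm : Real.exp (-2 * t / σsq) < Real.exp (-2 * u / σsq) := by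
    apply Real.exp_lt_exp.2
    apply div_lt_div_of_pos_right _ hs
    linarith
  have hc := Real.exp_pos (-2 / (σsq : ℝ))
  have hu := Real.exp_pos (2 * u / (σsq : ℝ))
  have ht := Real.exp_pos (-2 * t / (σsq : ℝ))
  generalize Real.exp (-2 / (σsq : ℝ)) = c at *
  generalize Real.exp (2 * u / (σsq : ℝ)) = yu at *
  generalize Real.exp (2 * t / (σsq : ℝ)) = yt at *
  generalize Real.exp (-2 * u / (σsq : ℝ)) = zu at *
  generalize Real.exp (-2 * t / (σsq : ℝ)) = zt at *
  have key : (c * yu + 1) * (1 + c * zt) < (c * yt + 1) * (1 + c * zu) := by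
    gcongr
  have hk : 0 < 2⁻¹ * gaussianPDFReal 0 σsq u * (2⁻¹ * gaussianPDFReal 0 σsq t) := by positivity
  nlinarith [mul_lt_mul_of_pos_left key hk]

/-- The difference of posteriors as a determinant. -/
theorem posterior_sub {σsq : ℝ≥0} (hσ : σsq ≠ 0) (u t : ℝ) :
    posterior σsq 1 u - posterior σsq 1 t =
      posterior σsq 1 u * posterior σsq (-1) t - posterior σsq (-1) u * posterior σsq 1 t := by
  have h1 := posterior_add hσ u
  have h2 := posterior_add hσ t
  linear_combination posterior σsq 1 t * h1 - posterior σsq 1 u * h2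

theorem strictMono_posterior {σsq : ℝ≥0} (hσ : σsq ≠ 0) : StrictMono (posterior σsq 1) := by
  intro u t hut
  have hu := add_pos (relayPDF_pos hσ 1 u) (relayPDF_pos hσ (-1) u)
  have ht := add_pos (relayPDF_pos hσ 1 t) (relayPDF_pos hσ (-1) t)
  have h := relayPDF_mul_lt hσ hut
  rw [posterior, posterior, div_lt_div_iff₀ hu ht]
  linarith

/-- Given `U`, the posterior is unbiased for the own symbol. -/
theorem integral_symbol_sub_posterior {σsq : ℝ≥0} (hσ : σsq ≠ 0) {a : ℝ} (ha : a = 1 ∨ a = -1)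
    {h : ℝ → ℝ} (hh : Measurable h) {C : ℝ} (hC : ∀ u, |h u| ≤ C) :
    ∫ p, h p.2 * ((if p.1 = a then 1 else 0) - posterior σsq a p.2) ∂(sampleLaw σsq) = 0 := by
  have hp := measurable_posterior σsq a
  have hb : ∀ x u : ℝ, |h u * ((if x = a then 1 else 0) - posterior σsq a u)| ≤ C := by
    intro x u
    have h0 := posterior_nonneg hσ a u
    have h1 := posterior_le_one hσ ha u
    have hle : |(if x = a then (1 : ℝ) else 0) - posterior σsq a u| ≤ 1 := by
      rw [abs_le]; split_ifs <;> constructor <;> linarith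
    rw [abs_mul]
    calc |h u| * _ ≤ C * 1 := mul_le_mul (hC u) hle (abs_nonneg _) ((abs_nonneg _).trans (hC u))
      _ = C := mul_one C
  have hm : Measurable fun p : ℝ × ℝ =>
      h p.2 * ((if p.1 = a then 1 else 0) - posterior σsq a p.2) :=
    (hh.comp measurable_snd).mul ((Measurable.ite
      (measurableSet_eq_fun measurable_fst measurable_const) measurable_const
      measurable_const).sub (hp.comp measurable_snd))
  rw [integral_sampleLaw σsq hm (fun p => hb p.1 p.2),
    integral_relayLaw hσ 1 (by fun_prop) (hb 1), integral_relayLaw hσ (-1) (by fun_prop) (hb (-1)),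
    ← mul_add]
  have h0 : ¬ (1 : ℝ) = -1 := by norm_num
  have h0' : ¬ (-1 : ℝ) = 1 := by norm_num
  -- The two symbols cancel pointwise: the density of `a` times `1 - p_a` equals the density of `-a`
  -- times `p_a`.
  suffices H : ∫ u, relayPDF σsq 1 u * (h u * ((if (1 : ℝ) = a then 1 else 0) - posterior σsq a u))
      = - ∫ u, relayPDF σsq (-1) u *
        (h u * ((if (-1 : ℝ) = a then 1 else 0) - posterior σsq a u)) by
    rw [H]; ring
  rw [← integral_neg]
  congr 1 with u
  have hu := (add_pos (relayPDF_pos hσ 1 u) (relayPDF_pos hσ (-1) u)).ne'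
  rcases ha with rfl | rfl
  · simp only [if_true, h0', if_false, posterior]; field_simp; ring
  · simp only [if_true, h0, if_false, posterior]; field_simp; ring

/-- Since the posterior is strictly monotone and `U` has no atom, the posterior is rarely close
to its value at a given point. -/
theorem eventually_sampleLaw_posterior_near_lt {σsq : ℝ≥0} (hσ : σsq ≠ 0) (t : ℝ) {ρ : ℝ}
    (hρ : 0 < ρ) : ∀ᶠ r in 𝓝[>] (0 : ℝ),
      (sampleLaw σsq).real {p | |posterior σsq 1 p.2 - posterior σsq 1 t| < r} < ρ := by
  have hp := measurable_posterior σsq 1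
  have h := tendsto_measure_biInter_gt (μ := sampleLaw σsq) (a := (0 : ℝ))
    (s := fun r => {p : ℝ × ℝ | |posterior σsq 1 p.2 - posterior σsq 1 t| < r})
    (fun r _ => (measurableSet_lt ((hp.comp measurable_snd).sub_const _).abs
      measurable_const).nullMeasurableSet)
    (fun i j _ hij p hpi => lt_of_lt_of_le hpi hij) ⟨1, one_pos, measure_ne_top _ _⟩
  have h0 : (⋂ r > (0 : ℝ), {p : ℝ × ℝ | |posterior σsq 1 p.2 - posterior σsq 1 t| < r}) =
      Prod.snd ⁻¹' {t} := by
    ext p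
    simp only [mem_iInter, mem_ofPred_eq, mem_preimage, mem_singleton_iff]
    constructor
    · intro hr
      by_contra hne
      have hne' : posterior σsq 1 p.2 - posterior σsq 1 t ≠ 0 :=
        sub_ne_zero.2 fun he => hne ((strictMono_posterior hσ).injective he)
      exact lt_irrefl _ (hr _ (abs_pos.2 hne'))
    · rintro rfl r hr
      simpa using hr
  rw [h0, sampleLaw_snd_singleton hσ] at h
  have h' := (ENNReal.tendsto_toReal ENNReal.zero_ne_top).comp h
  exact h'.eventually_lt_const hρ

/-! ### Laws of large numbers -/

/-- Chebyshev's inequality for the average of bounded, pairwise orthogonal variables. -/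
theorem measureReal_abs_average_ge_le {Ω : Type*} [MeasurableSpace Ω] (μ : Measure Ω)
    [IsProbabilityMeasure μ] {n : ℕ} (hn : 0 < n) {W : Fin n → Ω → ℝ}
    (hW : ∀ k, Measurable (W k)) {C : ℝ} (hC : ∀ k ω, |W k ω| ≤ C)
    (horth : ∀ k l, k ≠ l → ∫ ω, W k ω * W l ω ∂μ = 0) {η : ℝ} (hη : 0 < η) :
    μ.real {ω | η ≤ |(∑ k, W k ω) / n|} ≤ C ^ 2 / η ^ 2 / n := by
  have hn' : (0 : ℝ) < n := by exact_mod_cast hn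
  have hint : ∀ k l, Integrable (fun ω => W k ω * W l ω) μ := fun k l =>
    Integrable.of_bound ((hW k).mul (hW l)).aestronglyMeasurable (C * C) (ae_of_all _ fun ω => by
      rw [Real.norm_eq_abs, abs_mul]
      exact mul_le_mul (hC k ω) (hC l ω) (abs_nonneg _) ((abs_nonneg _).trans (hC k ω)))
  have hsq : ∀ ω, ((∑ k, W k ω) / n) ^ 2 = (∑ k, ∑ l, W k ω * W l ω) / (n : ℝ) ^ 2 := fun ω => by
    rw [div_pow, sq (∑ k, W k ω), Finset.sum_mul_sum]
  have hI : Integrable (fun ω => ((∑ k, W k ω) / n) ^ 2) μ := by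
    simp_rw [hsq]
    exact (integrable_finsetSum _ fun k _ => integrable_finsetSum _ fun l _ => hint k l).div_const _
  have hset : {ω | η ≤ |(∑ k, W k ω) / n|} = {ω | η ^ 2 ≤ ((∑ k, W k ω) / n) ^ 2} := by
    ext ω
    simp only [mem_ofPred_eq]
    rw [sq_le_sq, abs_of_pos hη]
  have hval : ∫ ω, ((∑ k, W k ω) / n) ^ 2 ∂μ ≤ C ^ 2 / n := by
    simp_rw [hsq]
    rw [integral_div, integral_finsetSum _ fun k _ => integrable_finsetSum _ fun l _ => hint k l]
    -- Orthogonality leaves only the diagonal term of each row, so the double sum is at most `n C²`.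
    have hk : ∀ k ∈ (Finset.univ : Finset (Fin n)),
        ∫ ω, ∑ l, W k ω * W l ω ∂μ ≤ C ^ 2 := fun k _ => by
      rw [integral_finsetSum _ fun l _ => hint k l, Finset.sum_eq_single k
        (fun l _ hl => horth k l hl.symm) (by simp)]
      calc ∫ ω, W k ω * W k ω ∂μ ≤ ∫ _, C ^ 2 ∂μ :=
            integral_mono (hint k k) (integrable_const _) fun ω => by
              simp only [← sq]
              exact sq_le_sq.2 ((hC k ω).trans (le_abs_self C))
        _ = C ^ 2 := by simp
    have hs := Finset.sum_le_sum hk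
    simp only [Finset.sum_const, Finset.card_univ, Fintype.card_fin, nsmul_eq_mul] at hs
    rw [div_le_div_iff₀ (by positivity) hn']
    calc _ ≤ (n * C ^ 2) * (n : ℝ) := by gcongr
      _ = _ := by ring
  have h := mul_meas_ge_le_integral_of_nonneg (ae_of_all μ fun ω => sq_nonneg ((∑ k, W k ω) / n))
    hI (η ^ 2)
  rw [hset, div_right_comm, le_div_iff₀ (by positivity), mul_comm]
  exact h.trans hval

/-- An integral over a product of identical laws vanishes if it does so in one coordinate. -/
theorem integral_pi_eq_zero_of_update {E : Type} [MeasurableSpace E] [Inhabited E]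
    (ν : Measure E) [IsProbabilityMeasure ν] {n : ℕ} (k : Fin n) {F : (Fin n → E) → ℝ}
    (hF : Measurable F) {C : ℝ} (hC : ∀ p, |F p| ≤ C)
    (h : ∀ p, ∫ x, F (Function.update p k x) ∂ν = 0) :
    ∫ p, F p ∂(Measure.pi fun _ => ν) = 0 := by
  obtain _ | n := n
  · exact k.elim0
  have hmp := (measurePreserving_piFinSuccAbove (fun _ : Fin (n + 1) => ν) k).symm
  rw [← hmp.integral_comp', integral_prod_symm]
  · refine integral_eq_zero_of_ae (ae_of_all _ fun q => ?_)
    -- Coordinate `k` is overwritten by the inner integration, so any filler serves there.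
    have h' := h (k.insertNth (default : E) q)
    simp only [Fin.update_insertNth] at h'
    exact h'
  · exact Integrable.of_bound (hF.comp (MeasurableEquiv.measurable _)).aestronglyMeasurable C
      (ae_of_all _ fun _ => hC _)

instance (σsq : ℝ≥0) {n : ℕ} (κ : Kernel (Fin n → ℝ) (Fin n → ℝ)) [IsMarkovKernel κ] :
    IsProbabilityMeasure (systemLaw σsq κ) := by
  have := isProbabilityMeasure_sourceLaw σsq n
  unfold systemLaw
  infer_instance

/-- Reduces expectations to i.i.d. pairs followed by a kernel that reads only their second
coordinates: this is the Markov chain `X₁ⁿ → Uⁿ → Vⁿ`. -/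
theorem integral_samples (σsq : ℝ≥0) {n : ℕ} (κ : Kernel (Fin n → ℝ) (Fin n → ℝ))
    [IsMarkovKernel κ] {F : (Fin n → ℝ × ℝ) → (Fin n → ℝ) → ℝ}
    (hF : Measurable fun q : (Fin n → ℝ × ℝ) × (Fin n → ℝ) => F q.1 q.2) {C : ℝ}
    (hC : ∀ p v, |F p v| ≤ C) :
    ∫ ω, F (samples ω.1) ω.2 ∂(systemLaw σsq κ) =
      ∫ p, ∫ v, F p v ∂(κ fun i => (p i).2) ∂(Measure.pi fun _ => sampleLaw σsq) := by
  have := isProbabilityMeasure_sourceLaw σsq n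
  have hm : Measurable fun p : Fin n → ℝ × ℝ => fun i => (p i).2 := by fun_prop
  have hi : Integrable (fun ω : Source n × (Fin n → ℝ) => F (samples ω.1) ω.2)
      (systemLaw σsq κ) :=
    Integrable.of_bound (hF.comp ((measurable_samples.comp measurable_fst).prodMk
      measurable_snd)).aestronglyMeasurable C (ae_of_all _ fun _ => hC _ _)
  have hs : StronglyMeasurable fun p : Fin n → ℝ × ℝ => ∫ v, F p v ∂(κ fun i => (p i).2) :=
    StronglyMeasurable.integral_kernel_prod_right' (κ := κ.comap _ hm) hF.stronglyMeasurable
  rw [systemLaw, Measure.integral_compProd hi, ← map_samples,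
    integral_map measurable_samples.aemeasurable hs.aestronglyMeasurable]
  rfl

/-- The events `bad n` have probabilities tending to `0`. -/
def Negligible {Ω : ℕ → Type*} [∀ n, MeasurableSpace (Ω n)] (P : ∀ n, Measure (Ω n))
    (bad : ∀ n, Set (Ω n)) : Prop :=
  Tendsto (fun n => (P n).real (bad n)) atTop (𝓝 0)

section Negligible

variable {Ω : ℕ → Type*} [∀ n, MeasurableSpace (Ω n)] {P : ∀ n, Measure (Ω n)}

theorem Negligible.mono [∀ n, IsProbabilityMeasure (P n)] {A B : ∀ n, Set (Ω n)}
    (hB : Negligible P B) (h : ∀ n, A n ⊆ B n) : Negligible P A :=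
  squeeze_zero (fun _ => measureReal_nonneg) (fun n => measureReal_mono (h n)) hB

theorem Negligible.union {A B : ∀ n, Set (Ω n)} (hA : Negligible P A) (hB : Negligible P B) :
    Negligible P fun n => A n ∪ B n :=
  squeeze_zero (fun _ => measureReal_nonneg) (fun _ => measureReal_union_le _ _)
    (by simpa using hA.add hB)

theorem Negligible.biUnion {ι : Type*} (s : Finset ι) {A : ι → ∀ n, Set (Ω n)}
    (hA : ∀ i ∈ s, Negligible P (A i)) : Negligible P fun n => ⋃ i ∈ s, A i n :=
  squeeze_zero (fun _ => measureReal_nonneg) (fun _ => measureReal_biUnion_finset_le _ _)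
    (by simpa using tendsto_finsetSum s hA)

theorem negligible_of_le_div {A : ∀ n, Set (Ω n)} {C : ℝ}
    (h : ∀ n, 0 < n → (P n).real (A n) ≤ C / n) : Negligible P A :=
  squeeze_zero' (Eventually.of_forall fun _ => measureReal_nonneg)
    ((eventually_gt_atTop 0).mono h) (tendsto_const_div_atTop_nhds_zero_nat C)

end Negligible

variable {σsq : ℝ≥0} {κ : (n : ℕ) → Kernel (Fin n → ℝ) (Fin n → ℝ)}
  [hκ : ∀ n, IsMarkovKernel (κ n)]

/-- The weak law of large numbers for functions of `(X₁ₖ, Uₖ)`. -/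
theorem negligible_average_sub_integral {g : ℝ × ℝ → ℝ} (hg : Measurable g) {C : ℝ}
    (hC : ∀ p, |g p| ≤ C) {η : ℝ} (hη : 0 < η) :
    Negligible (fun n => systemLaw σsq (κ n)) fun n =>
      {ω | η ≤ |(∑ k, g (samples ω.1 k)) / n - ∫ p, g p ∂(sampleLaw σsq)|} := by
  set m := ∫ p, g p ∂(sampleLaw σsq) with hm
  have hb : ∀ p, |g p - m| ≤ C + |m| := fun p => (abs_sub _ _).trans (by gcongr; exact hC p)
  have hint : Integrable g (sampleLaw σsq) :=
    Integrable.of_bound hg.aestronglyMeasurable C (ae_of_all _ hC)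
  refine negligible_of_le_div (C := (C + |m|) ^ 2 / η ^ 2) fun n hn => ?_
  have hn' : (n : ℝ) ≠ 0 := by exact_mod_cast hn.ne'
  have h := measureReal_abs_average_ge_le (systemLaw σsq (κ n)) hn
    (W := fun k ω => g (samples ω.1 k) - m)
    (fun k => (hg.comp ((measurable_pi_apply k).comp
      (measurable_samples.comp measurable_fst))).sub_const m)
    (fun k ω => hb _) (fun k l hkl => ?_) hη
  · simpa [Finset.sum_sub_distrib, sub_div, mul_div_cancel_left₀ _ hn'] using h
  · rw [integral_samples σsq (κ n) (F := fun p _ => (g (p k) - m) * (g (p l) - m))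
      (by fun_prop) (C := (C + |m|) * (C + |m|)) (fun p v => by
        rw [abs_mul]
        exact mul_le_mul (hb _) (hb _) (abs_nonneg _) ((abs_nonneg _).trans (hb (p k))))]
    simp only [integral_const, probReal_univ, one_smul]
    refine integral_pi_eq_zero_of_update _ k (by fun_prop) (C := (C + |m|) * (C + |m|))
      (fun p => ?_) (fun p => ?_)
    · rw [abs_mul]
      exact mul_le_mul (hb _) (hb _) (abs_nonneg _) ((abs_nonneg _).trans (hb (p k)))
    · simp only [Function.update_self, Function.update_of_ne hkl.symm]
      rw [integral_mul_const, integral_sub hint (integrable_const _)]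
      simp [hm]

/-- The weak law of large numbers for indicators of events about `(X₁ₖ, Uₖ)`. -/
theorem negligible_frequency_sub {S : Set (ℝ × ℝ)} (hS : MeasurableSet S) {η : ℝ} (hη : 0 < η) :
    Negligible (fun n => systemLaw σsq (κ n)) fun n =>
      {ω | η ≤ |(∑ k, S.indicator 1 (samples ω.1 k)) / n - (sampleLaw σsq).real S|} := by
  have h := negligible_average_sub_integral (σsq := σsq) (κ := κ) (g := S.indicator 1) (C := 1)
    (measurable_one.indicator hS) (fun p => by by_cases hp : p ∈ S <;> simp [hp]) hη
  rwa [integral_indicator_one hS] at h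

/-- A weak law of large numbers that no attack can spoil: averages of `φ (X₁ₖ, Uₖ)` weighted by
functions of `Vₖ` tend to zero if `φ` is conditionally centred given `U`. -/
theorem negligible_weighted_average {φ : ℝ × ℝ → ℝ} (hφ : Measurable φ) (hφ1 : ∀ p, |φ p| ≤ 1)
    (hφ0 : ∀ h : ℝ → ℝ, Measurable h → (∀ u, |h u| ≤ 1) →
      ∫ p, h p.2 * φ p ∂(sampleLaw σsq) = 0)
    {χ : ℝ → ℝ} (hχ : Measurable χ) (hχ1 : ∀ v, |χ v| ≤ 1) {η : ℝ} (hη : 0 < η) :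
    Negligible (fun n => systemLaw σsq (κ n)) fun n =>
      {ω | η ≤ |(∑ k, χ (ω.2 k) * φ (samples ω.1 k)) / n|} := by
  refine negligible_of_le_div (C := 1 ^ 2 / η ^ 2) fun n hn => ?_
  have mul_le : ∀ {a b : ℝ}, |a| ≤ 1 → |b| ≤ 1 → |a * b| ≤ 1 := fun {a b} ha hb => by
    rw [abs_mul]; exact mul_le_one₀ ha (abs_nonneg _) hb
  refine measureReal_abs_average_ge_le (systemLaw σsq (κ n)) hn
    (W := fun k ω => χ (ω.2 k) * φ (samples ω.1 k)) (fun k => ?_)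
    (fun k ω => mul_le (hχ1 _) (hφ1 _)) (fun k l hkl => ?_) hη
  · exact (hχ.comp ((measurable_pi_apply k).comp measurable_snd)).mul
      (hφ.comp ((measurable_pi_apply k).comp (measurable_samples.comp measurable_fst)))
  · rw [integral_samples σsq (κ n)
      (F := fun p v => (χ (v k) * φ (p k)) * (χ (v l) * φ (p l))) (by fun_prop) (C := 1)
      (fun p v => mul_le (mul_le (hχ1 _) (hφ1 _)) (mul_le (hχ1 _) (hφ1 _)))]
    have hK : Measurable fun u : Fin n → ℝ => ∫ v, χ (v k) * χ (v l) ∂(κ n u) :=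
      (StronglyMeasurable.integral_kernel (κ := κ n)
        (f := fun v : Fin n → ℝ => χ (v k) * χ (v l))
        (by fun_prop : Measurable fun v : Fin n → ℝ => χ (v k) * χ (v l)).stronglyMeasurable
        ).measurable
    have hK1 : ∀ u, |∫ v, χ (v k) * χ (v l) ∂(κ n u)| ≤ 1 := fun u => by
      have h := norm_integral_le_of_norm_le_const (μ := κ n u) (C := 1)
        (f := fun v : Fin n → ℝ => χ (v k) * χ (v l))
        (ae_of_all _ fun v => mul_le (hχ1 _) (hχ1 _))
      simpa using h
    set K : (Fin n → ℝ) → ℝ := fun u => ∫ v, χ (v k) * χ (v l) ∂(κ n u) with hKdef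
    -- Given the pairs, the attack enters the correlation of two terms only through `K`, a bounded
    -- function of the received block.
    have hsplit : ∀ p : Fin n → ℝ × ℝ,
        ∫ v, (χ (v k) * φ (p k)) * (χ (v l) * φ (p l)) ∂(κ n fun i => (p i).2) =
          K (fun i => (p i).2) * φ (p l) * φ (p k) := fun p => by
      rw [hKdef, mul_assoc, ← integral_mul_const]
      congr 1 with v
      ring
    simp_rw [hsplit]
    refine integral_pi_eq_zero_of_update _ k (C := 1) ?_
      (fun p => mul_le (mul_le (hK1 _) (hφ1 _)) (hφ1 _)) (fun p => ?_)
    · exact ((hK.comp (by fun_prop)).mul (hφ.comp (measurable_pi_apply l))).mul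
        (hφ.comp (measurable_pi_apply k))
    · have hupd : ∀ x : ℝ × ℝ, (fun i => (Function.update p k x i).2) =
          Function.update (fun i => (p i).2) k x.2 := fun x => by
        ext i
        rcases eq_or_ne i k with rfl | hi
        · simp
        · simp [Function.update_of_ne hi]
      simp only [Function.update_self, Function.update_of_ne hkl.symm, hupd]
      -- With all pairs but the `k`-th frozen, the factor of `φ` depends on that pair only through
      -- its received value, so conditional centring applies.
      exact hφ0 (fun u => K (Function.update (fun i => (p i).2) k u) * φ (p l))
        ((hK.comp (measurable_update _)).mul_const _) (fun u => mul_le (hK1 _) (hφ1 _))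

/-! ### The quantization grid -/

namespace QuantGrid

variable (G : QuantGrid) {m : ℕ}

theorem point_of_ne {j : ℕ} (hj : j ≠ m) :
    G.point m j = G.α + ((j : ℝ) - 1) * ((G.β - G.α) / ((m : ℝ) - 2)) := if_neg hj

theorem point_one (hm : 3 ≤ m) : G.point m 1 = G.α := by
  rw [G.point_of_ne (by omega)]; simp

theorem point_pred (hm : 3 ≤ m) : G.point m (m - 1) = G.β := by
  have h : (0 : ℝ) < (m : ℝ) - 2 := by
    have : (3 : ℝ) ≤ m := by exact_mod_cast hm
    linarith
  rw [G.point_of_ne (by omega), Nat.cast_sub (by omega)]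
  field_simp
  push_cast
  ring

theorem point_lt_point {i j : ℕ} (hm : 3 ≤ m) (hij : i < j) (hj : j ≤ m) :
    G.point m i < G.point m j := by
  have h : (0 : ℝ) < (m : ℝ) - 2 := by
    have : (3 : ℝ) ≤ m := by exact_mod_cast hm
    linarith
  have hstep : 0 < (G.β - G.α) / ((m : ℝ) - 2) := div_pos (sub_pos.2 G.α_lt_β) h
  have mono : ∀ {i j : ℕ}, i ≤ j → j < m → G.point m i ≤ G.point m j := fun {i j} h1 h2 => by
    rw [G.point_of_ne (by omega), G.point_of_ne (by omega)]
    gcongr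
  -- The last point `γ` is off the arithmetic progression and is compared through `β`.
  rcases eq_or_lt_of_le hj with rfl | hj
  · calc G.point j i ≤ G.point j (j - 1) := mono (by omega) (by omega)
      _ = G.β := G.point_pred hm
      _ < G.γ := G.β_lt_γ
      _ = G.point j j := by simp [point]
  · rw [G.point_of_ne (by omega), G.point_of_ne (by omega)]
    gcongr

theorem point_le_point_iff {i j : ℕ} (hm : 3 ≤ m) (hi : i ∈ Finset.Icc 1 m)
    (hj : j ∈ Finset.Icc 1 m) : G.point m i ≤ G.point m j ↔ i ≤ j := by
  rw [Finset.mem_Icc] at hi hj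
  constructor
  · intro h
    by_contra! hlt
    exact absurd h (not_le.2 (G.point_lt_point hm hlt hi.2))
  · intro h
    rcases eq_or_lt_of_le h with rfl | h
    · exact le_rfl
    · exact (G.point_lt_point hm h hj.2).le

theorem cell_eq_Ioc {i : ℕ} (h1 : i ≠ 1) (h2 : i ≠ m) :
    G.cell m i = Ioc (G.point m (i - 1)) (G.point m i) := by simp [cell, h1, h2]

theorem cell_one : G.cell m 1 = Iic G.α := by simp [cell]

theorem cell_last (hm : 3 ≤ m) : G.cell m m = Ioi G.β := by
  simp [cell, show m ≠ 1 by omega]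

/-- No cell straddles a test point. The index `j = m` is excluded because `γ` lies inside the last
cell. -/
theorem le_point_iff_of_mem_cell {i j : ℕ} (hm : 3 ≤ m) (hi : i ∈ Finset.Icc 1 m)
    (hj : j ∈ Finset.Icc 1 (m - 1)) {u : ℝ} (hu : u ∈ G.cell m i) :
    u ≤ G.point m j ↔ i ≤ j := by
  have hi' := Finset.mem_Icc.1 hi
  have hj' := Finset.mem_Icc.1 hj
  have mono : ∀ {k l : ℕ}, 1 ≤ k → k ≤ l → l ≤ m → G.point m k ≤ G.point m l := fun h1 h2 h3 =>
    (G.point_le_point_iff hm (Finset.mem_Icc.2 ⟨h1, h2.trans h3⟩)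
      (Finset.mem_Icc.2 ⟨h1.trans h2, h3⟩)).2 h2
  rcases eq_or_ne i 1 with rfl | h1
  · rw [cell_one, mem_Iic, ← G.point_one hm] at hu
    exact ⟨fun _ => hj'.1, fun h => hu.trans (mono le_rfl h (by omega))⟩
  rcases eq_or_ne i m with rfl | h2
  · rw [G.cell_last hm, mem_Ioi, ← G.point_pred hm] at hu
    exact ⟨fun h => absurd (h.trans (mono hj'.1 hj'.2 (by omega))) (not_le.2 hu),
      fun h => by omega⟩
  rw [G.cell_eq_Ioc h1 h2] at hu
  refine ⟨fun h => ?_, fun h => hu.2.trans (mono hi'.1 h (by omega))⟩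
  by_contra! hlt
  exact absurd (h.trans (mono hj'.1 (by omega) (by omega))) (not_le.2 hu.1)

theorem exists_mem_cell (hm : 3 ≤ m) (u : ℝ) : ∃ i ∈ Finset.Icc 1 m, u ∈ G.cell m i := by
  rcases le_or_gt u G.α with hα | hα
  · exact ⟨1, Finset.mem_Icc.2 ⟨le_rfl, by omega⟩, by rwa [cell_one]⟩
  rcases lt_or_ge G.β u with hβ | hβ
  · exact ⟨m, Finset.mem_Icc.2 ⟨by omega, le_rfl⟩, by rwa [G.cell_last hm]⟩
  classical
  -- The cell of `u` ends at the first grid point that is at least `u`.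
  have hex : ∃ j, 1 ≤ j ∧ u ≤ G.point m j := ⟨m - 1, by omega, by rwa [G.point_pred hm]⟩
  obtain ⟨h1, h2⟩ := Nat.find_spec hex
  have hle : Nat.find hex ≤ m - 1 := Nat.find_min' hex ⟨by omega, by rwa [G.point_pred hm]⟩
  have hne : Nat.find hex ≠ 1 := fun h => by
    rw [h, G.point_one hm] at h2
    exact absurd h2 (not_le.2 hα)
  refine ⟨Nat.find hex, Finset.mem_Icc.2 ⟨h1, by omega⟩, ?_⟩
  rw [G.cell_eq_Ioc hne (by omega)]
  refine ⟨?_, h2⟩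
  by_contra! h
  exact Nat.find_min hex (m := Nat.find hex - 1) (by omega) ⟨by omega, h⟩

theorem measurableSet_cell (i : ℕ) : MeasurableSet (G.cell m i) := by
  unfold cell
  split_ifs
  exacts [measurableSet_Iic, measurableSet_Ioi, measurableSet_Ioc]

theorem volume_cell_ne_zero (hm : 3 ≤ m) {i : ℕ} (hi : i ∈ Finset.Icc 1 m) :
    volume (G.cell m i) ≠ 0 := by
  rw [Finset.mem_Icc] at hi
  rcases eq_or_ne i 1 with rfl | h1
  · simp [cell_one]
  rcases eq_or_ne i m with rfl | h2
  · simp [G.cell_last hm]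
  · have := G.point_lt_point hm (i := i - 1) (j := i) (by omega) hi.2
    rw [G.cell_eq_Ioc h1 h2, Real.volume_Ioc]
    simpa using this

end QuantGrid

/-! ### Deviation of the forwarded from the received sequence -/

/-- The difference of the indicators of `v ≤ t` and `u ≤ t`. -/
def stepDiff (t u v : ℝ) : ℝ := (if v ≤ t then 1 else 0) - if u ≤ t then 1 else 0

theorem abs_stepDiff_le_one (t u v : ℝ) : |stepDiff t u v| ≤ 1 := by
  unfold stepDiff
  split_ifs <;> simp

variable {n : ℕ} {G : QuantGrid} {m : ℕ}

open Classical in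
theorem quantEmpCDF_eq (u v : Fin n → ℝ) (t : ℝ) (i : ℕ) :
    quantEmpCDF G m u v t i = (∑ k, if v k ≤ t ∧ u k ∈ G.cell m i then (1 : ℝ) else 0) /
      ∑ k, if u k ∈ G.cell m i then (1 : ℝ) else 0 := by
  rw [quantEmpCDF, Finset.natCast_card_filter, Finset.natCast_card_filter]

open Classical in
theorem condEmpCDF_eq (x v : Fin n → ℝ) (t a : ℝ) :
    condEmpCDF x v t a = (∑ k, if v k ≤ t ∧ x k = a then (1 : ℝ) else 0) /
      ∑ k, if x k = a then (1 : ℝ) else 0 := by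
  rw [condEmpCDF, Finset.natCast_card_filter, Finset.natCast_card_filter]

open Classical in
/-- The contribution of one cell to the total deviation at a grid point. -/
theorem quantEmpCDF_sub_unitStep (hm : 3 ≤ m) {i j : ℕ} (hi : i ∈ Finset.Icc 1 m)
    (hj : j ∈ Finset.Icc 1 (m - 1)) (u v : Fin n → ℝ) :
    |quantEmpCDF G m u v (G.point m j) i - unitStep (G.point m j - G.point m i)| *
        (∑ k, if u k ∈ G.cell m i then (1 : ℝ) else 0) =
      ∑ k, if u k ∈ G.cell m i then |stepDiff (G.point m j) (u k) (v k)| else 0 := by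
  set N : ℝ := ∑ k, if u k ∈ G.cell m i then (1 : ℝ) else 0 with hN
  have hN0 : 0 ≤ N := Finset.sum_nonneg fun k _ => by split_ifs <;> norm_num
  -- For an empty cell the convention for the empirical distribution function is immaterial, since
  -- it is multiplied by the count `0`.
  rcases hN0.eq_or_lt with h0 | hpos
  · have h := (Finset.sum_eq_zero_iff_of_nonneg (fun k _ => by split_ifs <;> norm_num)).1 h0.symm
    rw [← h0, mul_zero, Finset.sum_eq_zero]
    intro k hk
    have := h k hk
    by_cases hc : u k ∈ G.cell m i
    · simp [hc] at this
    · simp [hc]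
  · have hj2 : j ∈ Finset.Icc 1 m := by rw [Finset.mem_Icc] at hj ⊢; omega
    have hs : unitStep (G.point m j - G.point m i) = if i ≤ j then 1 else 0 := by
      simp [unitStep, G.point_le_point_iff hm hi hj2]
    rw [← abs_of_pos hpos, ← abs_mul, sub_mul, quantEmpCDF_eq,
      div_mul_cancel₀ _ hpos.ne', hs, hN, Finset.mul_sum, ← Finset.sum_sub_distrib]
    -- Within one cell the step differences share a sign, nonpositive for `i ≤ j` and nonnegative
    -- otherwise, so the absolute value passes inside the sum.
    by_cases hij : i ≤ j
    · rw [← abs_neg, ← Finset.sum_neg_distrib, abs_of_nonneg]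
      · refine Finset.sum_congr rfl fun k _ => ?_
        by_cases hc : u k ∈ G.cell m i
        · have := (G.le_point_iff_of_mem_cell hm hi hj hc).2 hij
          by_cases hv : v k ≤ G.point m j <;> simp [hc, hv, hij, this, stepDiff]
        · simp [hc]
      · refine Finset.sum_nonneg fun k _ => ?_
        by_cases hc : u k ∈ G.cell m i <;> by_cases hv : v k ≤ G.point m j <;> simp [hc, hv, hij]
    · rw [abs_of_nonneg]
      · refine Finset.sum_congr rfl fun k _ => ?_
        by_cases hc : u k ∈ G.cell m i
        · have : ¬ u k ≤ G.point m j := fun h =>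
            hij ((G.le_point_iff_of_mem_cell hm hi hj hc).1 h)
          by_cases hv : v k ≤ G.point m j <;> simp [hc, hv, hij, this, stepDiff]
        · simp [hc]
      · refine Finset.sum_nonneg fun k _ => ?_
        by_cases hc : u k ∈ G.cell m i <;> by_cases hv : v k ≤ G.point m j <;> simp [hc, hv, hij]

/-- The attack measure controls the average deviation at each grid point. -/
theorem sum_abs_stepDiff_le_mul_attackMeasure (hm : 3 ≤ m) {j : ℕ}
    (hj : j ∈ Finset.Icc 1 (m - 1)) (u v : Fin n → ℝ) :
    ∑ k, |stepDiff (G.point m j) (u k) (v k)| ≤ n * attackMeasure G m u v := by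
  classical
  -- That the cells cover the line is enough here; each cell count is then bounded by `n`.
  calc ∑ k, |stepDiff (G.point m j) (u k) (v k)|
      ≤ ∑ k, ∑ i ∈ Finset.Icc 1 m,
          if u k ∈ G.cell m i then |stepDiff (G.point m j) (u k) (v k)| else 0 := by
        refine Finset.sum_le_sum fun k _ => ?_
        obtain ⟨i, hi, hu⟩ := G.exists_mem_cell hm (u k)
        have := Finset.single_le_sum (f := fun i =>
          if u k ∈ G.cell m i then |stepDiff (G.point m j) (u k) (v k)| else 0)
          (fun i _ => by split_ifs <;> positivity) hi
        simpa [hu] using this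
    _ = ∑ i ∈ Finset.Icc 1 m,
          |quantEmpCDF G m u v (G.point m j) i - unitStep (G.point m j - G.point m i)| *
            (∑ k, if u k ∈ G.cell m i then (1 : ℝ) else 0) := by
        rw [Finset.sum_comm]
        exact Finset.sum_congr rfl fun i hi => (quantEmpCDF_sub_unitStep hm hi hj u v).symm
    _ ≤ ∑ i ∈ Finset.Icc 1 m,
          |quantEmpCDF G m u v (G.point m j) i - unitStep (G.point m j - G.point m i)| * n := by
        refine Finset.sum_le_sum fun i _ => mul_le_mul_of_nonneg_left ?_ (abs_nonneg _)
        calc (∑ k, if u k ∈ G.cell m i then (1 : ℝ) else 0) ≤ ∑ _k : Fin n, (1 : ℝ) :=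
              Finset.sum_le_sum fun k _ => by split_ifs <;> norm_num
          _ = n := by simp
    _ = n * ∑ i ∈ Finset.Icc 1 m,
          |quantEmpCDF G m u v (G.point m j) i - unitStep (G.point m j - G.point m i)| := by
        rw [← Finset.sum_mul, mul_comm]
    _ ≤ n * attackMeasure G m u v := by
        refine mul_le_mul_of_nonneg_left ?_ (Nat.cast_nonneg n)
        exact Finset.single_le_sum (f := fun j => ∑ i ∈ Finset.Icc 1 m,
          |quantEmpCDF G m u v (G.point m j) i - unitStep (G.point m j - G.point m i)|)
          (fun j _ => Finset.sum_nonneg fun i _ => abs_nonneg _) hj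

open Classical in
/-- If all cells are well populated, small average deviations at the grid points force a small
attack measure. -/
theorem attackMeasure_le (hm : 3 ≤ m) (u v : Fin n → ℝ) {q τ : ℝ} (hq : 0 < q)
    (hcell : ∀ i ∈ Finset.Icc 1 m, q ≤ (∑ k, if u k ∈ G.cell m i then (1 : ℝ) else 0) / n)
    (hdev : ∀ j ∈ Finset.Icc 1 (m - 1),
      (∑ k, |stepDiff (G.point m j) (u k) (v k)|) / n ≤ τ) :
    attackMeasure G m u v ≤ m * m * (τ / q) := by
  have hn : (0 : ℝ) < n := by
    rcases Nat.eq_zero_or_pos n with rfl | h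
    · have := hcell 1 (Finset.mem_Icc.2 ⟨le_rfl, by omega⟩)
      simp at this
      linarith
    · exact_mod_cast h
  have hτ : 0 ≤ τ := le_trans (by positivity) (hdev 1 (Finset.mem_Icc.2 ⟨le_rfl, by omega⟩))
  have hterm : ∀ j ∈ Finset.Icc 1 (m - 1), ∀ i ∈ Finset.Icc 1 m,
      |quantEmpCDF G m u v (G.point m j) i - unitStep (G.point m j - G.point m i)| ≤ τ / q := by
    intro j hj i hi
    have h := quantEmpCDF_sub_unitStep (G := G) hm hi hj u v
    have hN := (le_div_iff₀ hn).1 (hcell i hi)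
    have hD := (div_le_iff₀ hn).1 (hdev j hj)
    have hle : (∑ k, if u k ∈ G.cell m i then |stepDiff (G.point m j) (u k) (v k)| else 0) ≤
        ∑ k, |stepDiff (G.point m j) (u k) (v k)| :=
      Finset.sum_le_sum fun k _ => by split_ifs <;> simp
    have habs := abs_nonneg
      (quantEmpCDF G m u v (G.point m j) i - unitStep (G.point m j - G.point m i))
    rw [le_div_iff₀ hq]
    have h3 := mul_le_mul_of_nonneg_left hN habs
    refine le_of_mul_le_mul_right ?_ hn
    linarith
  calc attackMeasure G m u v ≤ ∑ j ∈ Finset.Icc 1 (m - 1), ∑ i ∈ Finset.Icc 1 m, τ / q :=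
        Finset.sum_le_sum fun j hj => Finset.sum_le_sum fun i hi => hterm j hj i hi
    _ = ((m - 1 : ℕ) : ℝ) * (m * (τ / q)) := by simp
    _ ≤ m * (m * (τ / q)) := by
        gcongr
        omega
    _ = _ := by ring

/-! ### Deterministic comparison of the statistic with the average deviation. -/

theorem ite_and_sub (t a x u v : ℝ) :
    (if v ≤ t ∧ x = a then (1 : ℝ) else 0) - (if u ≤ t ∧ x = a then 1 else 0) =
      stepDiff t u v * if x = a then 1 else 0 := by
  by_cases h1 : x = a <;> simp [stepDiff, h1]

/-- Small average deviation makes the statistic of one symbol at one grid point small. -/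
theorem abs_condEmpCDF_sub_le {x u v : Fin n → ℝ} {t a F η δ : ℝ} (hη : η ≤ 1 / 4)
    (hF0 : 0 ≤ F) (hF1 : F ≤ 1)
    (hA : |(∑ k, if x k = a then (1 : ℝ) else 0) / n - 1 / 2| ≤ η)
    (hB : |(∑ k, if u k ≤ t ∧ x k = a then (1 : ℝ) else 0) / n - F / 2| ≤ η)
    (hd : ∑ k, |stepDiff t (u k) (v k)| ≤ n * δ) :
    |condEmpCDF x v t a - F| ≤ 4 * (δ + 2 * η) := by
  have hn : (0 : ℝ) < n := by
    rcases Nat.eq_zero_or_pos n with rfl | h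
    · norm_num [abs_le] at hA
      linarith
    · exact_mod_cast h
  have hδ : |(∑ k, if v k ≤ t ∧ x k = a then (1 : ℝ) else 0) / n -
      (∑ k, if u k ≤ t ∧ x k = a then (1 : ℝ) else 0) / n| ≤ δ := by
    rw [← sub_div, ← Finset.sum_sub_distrib, abs_div, abs_of_pos hn, div_le_iff₀ hn, mul_comm]
    refine le_trans ((Finset.abs_sum_le_sum_abs _ _).trans (Finset.sum_le_sum fun k _ => ?_)) hd
    rw [ite_and_sub, abs_mul]
    split_ifs <;> simp
  rw [condEmpCDF_eq, ← div_div_div_cancel_right₀ hn.ne']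
  set A := (∑ k, if x k = a then (1 : ℝ) else 0) / n
  set B := (∑ k, if v k ≤ t ∧ x k = a then (1 : ℝ) else 0) / n
  set B' := (∑ k, if u k ≤ t ∧ x k = a then (1 : ℝ) else 0) / n
  rw [abs_le] at hA hB hδ
  -- The symbol frequency is at least `1/4`, so dividing by it costs the factor `4`.
  have hA4 : 1 / 4 ≤ A := by linarith
  have hA0 : 0 < A := by linarith
  have hδη : 0 ≤ δ + 2 * η := by linarith
  rw [div_sub' hA0.ne', abs_div, abs_of_pos hA0, div_le_iff₀ hA0]
  -- Split `B - A F` as `(B - B') + (B' - F/2) + (1/2 - A) F`.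
  have h1 : |B - A * F| ≤ δ + 2 * η := by
    have h2 : (A - 1 / 2) * F ≤ η * 1 := by
      refine (mul_le_mul_of_nonneg_right hA.2 hF0).trans ?_
      exact mul_le_mul_of_nonneg_left hF1 (by linarith)
    have h3 : (1 / 2 - A) * F ≤ η * 1 := by
      refine (mul_le_mul_of_nonneg_right (show 1 / 2 - A ≤ η by linarith) hF0).trans ?_
      exact mul_le_mul_of_nonneg_left hF1 (by linarith)
    rw [abs_le]
    constructor <;> linarith
  nlinarith

/-- A small statistic of one symbol at one grid point makes the deviation small on average, when
weighted with the posterior probability `p` of the symbol. -/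
theorem abs_sum_stepDiff_mul_le {x u v : Fin n → ℝ} {t a F η θ : ℝ} {p : ℝ → ℝ} (hη : η ≤ 1 / 4)
    (hF0 : 0 ≤ F) (hF1 : F ≤ 1)
    (hA : |(∑ k, if x k = a then (1 : ℝ) else 0) / n - 1 / 2| ≤ η)
    (hB : |(∑ k, if u k ≤ t ∧ x k = a then (1 : ℝ) else 0) / n - F / 2| ≤ η)
    (hv : |(∑ k, (if v k ≤ t then 1 else 0) * ((if x k = a then (1 : ℝ) else 0) - p (u k))) / n|
      ≤ η)
    (hu : |(∑ k, (if u k ≤ t then 1 else 0) * ((if x k = a then (1 : ℝ) else 0) - p (u k))) / n|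
      ≤ η)
    (hD : |condEmpCDF x v t a - F| ≤ θ) :
    |(∑ k, stepDiff t (u k) (v k) * p (u k)) / n| ≤ θ + 4 * η := by
  have hn : (0 : ℝ) < n := by
    rcases Nat.eq_zero_or_pos n with rfl | h
    · norm_num [abs_le] at hA
      linarith
    · exact_mod_cast h
  have hA1 : (∑ k, if x k = a then (1 : ℝ) else 0) / n ≤ 1 := by
    rw [div_le_one hn]
    calc (∑ k, if x k = a then (1 : ℝ) else 0) ≤ ∑ _k : Fin n, (1 : ℝ) :=
          Finset.sum_le_sum fun k _ => by split_ifs <;> norm_num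
      _ = n := by simp
  -- Write `p` as the indicator of `x = a` minus its centred version. The indicator part costs `θ +
  -- 2η`, the two centred averages `η` each.
  have hid : (∑ k, stepDiff t (u k) (v k) * p (u k)) / n =
      (∑ k, if v k ≤ t ∧ x k = a then (1 : ℝ) else 0) / n -
      (∑ k, if u k ≤ t ∧ x k = a then (1 : ℝ) else 0) / n -
      (∑ k, (if v k ≤ t then 1 else 0) * ((if x k = a then (1 : ℝ) else 0) - p (u k))) / n +
      (∑ k, (if u k ≤ t then 1 else 0) * ((if x k = a then (1 : ℝ) else 0) - p (u k))) / n := by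
    rw [← sub_div, ← sub_div, ← add_div, ← Finset.sum_sub_distrib, ← Finset.sum_sub_distrib,
      ← Finset.sum_add_distrib]
    congr 1
    refine Finset.sum_congr rfl fun k _ => ?_
    rw [ite_and_sub, stepDiff]
    ring
  rw [hid]
  rw [condEmpCDF_eq, ← div_div_div_cancel_right₀ hn.ne'] at hD
  set A := (∑ k, if x k = a then (1 : ℝ) else 0) / n
  set B := (∑ k, if v k ≤ t ∧ x k = a then (1 : ℝ) else 0) / n
  set B' := (∑ k, if u k ≤ t ∧ x k = a then (1 : ℝ) else 0) / n
  rw [abs_le] at hA hB hv hu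
  have hA0 : 0 < A := by linarith
  have hBA : |B - A * F| ≤ θ := by
    rw [div_sub' hA0.ne', abs_div, abs_of_pos hA0, div_le_iff₀ hA0] at hD
    have hθ : 0 ≤ θ := by
      by_contra! h
      have := mul_neg_of_neg_of_pos h hA0
      linarith [abs_nonneg (B - A * F)]
    exact hD.trans (mul_le_of_le_one_right hθ hA1)
  have h2 : (A - 1 / 2) * F ≤ η * 1 := by
    refine (mul_le_mul_of_nonneg_right hA.2 hF0).trans ?_
    exact mul_le_mul_of_nonneg_left hF1 (by linarith)
  have h3 : (1 / 2 - A) * F ≤ η * 1 := by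
    refine (mul_le_mul_of_nonneg_right (show 1 / 2 - A ≤ η by linarith) hF0).trans ?_
    exact mul_le_mul_of_nonneg_left hF1 (by linarith)
  rw [abs_le] at hBA ⊢
  constructor <;> linarith

/-- Deviations weighted by the distance of the posteriors: here monotonicity of the posterior
excludes any cancellation. -/
theorem sum_abs_stepDiff_mul_le {σsq : ℝ≥0} (hσ : σsq ≠ 0) {u v : Fin n → ℝ} {t ζ : ℝ}
    (h : ∀ a : ℝ, a = 1 ∨ a = -1 →
      |(∑ k, stepDiff t (u k) (v k) * posterior σsq a (u k)) / n| ≤ ζ) :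
    (∑ k, |stepDiff t (u k) (v k)| * |posterior σsq 1 (u k) - posterior σsq 1 t|) / n ≤ ζ := by
  have hmono := strictMono_posterior hσ
  -- The combination of the two hypotheses with weights `p_{-1}(t)` and `-p_1(t)` produces the
  -- difference of posteriors of `posterior_sub`.
  have hid : (∑ k, |stepDiff t (u k) (v k)| * |posterior σsq 1 (u k) - posterior σsq 1 t|) / n =
      posterior σsq (-1) t * ((∑ k, stepDiff t (u k) (v k) * posterior σsq 1 (u k)) / n) -
      posterior σsq 1 t * ((∑ k, stepDiff t (u k) (v k) * posterior σsq (-1) (u k)) / n) := by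
    rw [mul_div_assoc', mul_div_assoc', ← sub_div, Finset.mul_sum, Finset.mul_sum,
      ← Finset.sum_sub_distrib]
    congr 1
    refine Finset.sum_congr rfl fun k _ => ?_
    rw [← abs_mul, abs_of_nonneg, posterior_sub hσ]
    · ring
    · rcases le_or_gt (u k) t with hk | hk
      · refine mul_nonneg_of_nonpos_of_nonpos ?_ (sub_nonpos.2 (hmono.monotone hk))
        simp only [stepDiff, hk, if_true]
        split_ifs <;> norm_num
      · refine mul_nonneg ?_ (sub_nonneg.2 (hmono hk).le)
        simp only [stepDiff, not_le.2 hk, if_false]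
        split_ifs <;> norm_num
  have h1 := abs_le.1 (h 1 (Or.inl rfl))
  have h2 := abs_le.1 (h (-1) (Or.inr rfl))
  have p1 := posterior_nonneg hσ 1 t
  have p2 := posterior_nonneg hσ (-1) t
  have hadd := posterior_add hσ t
  rw [hid]
  have e1 := mul_le_mul_of_nonneg_left h1.2 p2
  have e2 := mul_le_mul_of_nonneg_left h2.1 p1
  have e3 : posterior σsq 1 t * ζ + posterior σsq (-1) t * ζ = ζ := by
    rw [← add_mul, hadd, one_mul]
  linarith

/-- A Markov-type bound: splitting according to whether a nonnegative weight is below `r`. -/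
theorem sum_le_of_weighted_sum_le {d w : Fin n → ℝ} (hd0 : ∀ k, 0 ≤ d k) (hd1 : ∀ k, d k ≤ 1)
    (hw : ∀ k, 0 ≤ w k) {r ζ ρ : ℝ} (hr : 0 < r) (hζ : (∑ k, d k * w k) / n ≤ ζ)
    (hρ : (∑ k, if w k < r then (1 : ℝ) else 0) / n ≤ ρ) :
    (∑ k, d k) / n ≤ ρ + ζ / r := by
  -- Use `d ≤ 1` where `w < r`, and `d ≤ d w / r` elsewhere.
  have h1 : ∑ k, d k ≤ (∑ k, if w k < r then (1 : ℝ) else 0) + (∑ k, d k * w k) / r := by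
    rw [Finset.sum_div, ← Finset.sum_add_distrib]
    refine Finset.sum_le_sum fun k _ => ?_
    have hk := div_nonneg (mul_nonneg (hd0 k) (hw k)) hr.le
    split_ifs with hwr
    · linarith [hd1 k]
    · rw [zero_add, mul_div_assoc]
      exact le_mul_of_one_le_right (hd0 k) ((one_le_div hr).2 (not_lt.1 hwr))
  calc (∑ k, d k) / n ≤ ((∑ k, if w k < r then (1 : ℝ) else 0) + (∑ k, d k * w k) / r) / n := by
        gcongr
    _ = (∑ k, if w k < r then (1 : ℝ) else 0) / n + ((∑ k, d k * w k) / n) / r := by ring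
    _ ≤ ρ + ζ / r := by gcongr

/-! ### Typical sequences -/

section Typical

variable {σsq : ℝ≥0} {κ : (n : ℕ) → Kernel (Fin n → ℝ) (Fin n → ℝ)}
  [hκ : ∀ n, IsMarkovKernel (κ n)] {η : ℝ}

theorem negligible_symbol_frequency {a : ℝ} (ha : a = 1 ∨ a = -1) (hη : 0 < η) :
    Negligible (fun n => systemLaw σsq (κ n)) fun n =>
      {ω | η ≤ |(∑ k, if ω.1.1 k = a then (1 : ℝ) else 0) / n - 1 / 2|} := by
  have h := negligible_frequency_sub (σsq := σsq) (κ := κ) (S := {p | p.1 = a})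
    (measurableSet_eq_fun measurable_fst measurable_const) hη
  rw [sampleLaw_real_symbol_eq σsq ha] at h
  simpa only [indicator_apply, mem_ofPred_eq, samples, Pi.one_apply] using h

theorem negligible_symbol_le_frequency (hσ : σsq ≠ 0) {a : ℝ} (ha : a = 1 ∨ a = -1) (t : ℝ)
    (hη : 0 < η) :
    Negligible (fun n => systemLaw σsq (κ n)) fun n =>
      {ω | η ≤ |(∑ k, if relayInput ω.1 k ≤ t ∧ ω.1.1 k = a then (1 : ℝ) else 0) / n -
        relayCDF σsq a t / 2|} := by
  have h := negligible_frequency_sub (σsq := σsq) (κ := κ) (S := {p | p.2 ≤ t ∧ p.1 = a})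
    ((measurableSet_le measurable_snd measurable_const).inter
      (measurableSet_eq_fun measurable_fst measurable_const)) hη
  rw [sampleLaw_real_symbol_eq_inter_Iic hσ ha] at h
  simpa only [indicator_apply, mem_ofPred_eq, samples, Pi.one_apply] using h

theorem negligible_posterior_near (t r : ℝ) (hη : 0 < η) :
    Negligible (fun n => systemLaw σsq (κ n)) fun n =>
      {ω | η ≤ |(∑ k, if |posterior σsq 1 (relayInput ω.1 k) - posterior σsq 1 t| < r
          then (1 : ℝ) else 0) / n -
        (sampleLaw σsq).real {p | |posterior σsq 1 p.2 - posterior σsq 1 t| < r}|} := by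
  have hp := measurable_posterior σsq 1
  have h := negligible_frequency_sub (σsq := σsq) (κ := κ)
    (S := {p | |posterior σsq 1 p.2 - posterior σsq 1 t| < r})
    (measurableSet_lt ((hp.comp measurable_snd).sub_const _).abs measurable_const) hη
  simpa only [indicator_apply, mem_ofPred_eq, samples, Pi.one_apply] using h

open Classical in
theorem negligible_cell_frequency (G : QuantGrid) (m i : ℕ) (hη : 0 < η) :
    Negligible (fun n => systemLaw σsq (κ n)) fun n =>
      {ω | η ≤ |(∑ k, if relayInput ω.1 k ∈ G.cell m i then (1 : ℝ) else 0) / n -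
        (sampleLaw σsq).real (Prod.snd ⁻¹' G.cell m i)|} := by
  have h := negligible_frequency_sub (σsq := σsq) (κ := κ) (S := Prod.snd ⁻¹' G.cell m i)
    (measurable_snd (G.measurableSet_cell i)) hη
  simpa only [indicator_apply, mem_preimage, samples, Pi.one_apply] using h

theorem abs_symbol_sub_posterior_le_one (hσ : σsq ≠ 0) {a : ℝ} (ha : a = 1 ∨ a = -1) (x u : ℝ) :
    |(if x = a then 1 else 0) - posterior σsq a u| ≤ 1 := by
  have h0 := posterior_nonneg hσ a u
  have h1 := posterior_le_one hσ ha u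
  rw [abs_le]
  split_ifs <;> constructor <;> linarith

theorem measurable_symbol_sub_posterior (a : ℝ) :
    Measurable fun p : ℝ × ℝ => (if p.1 = a then 1 else 0) - posterior σsq a p.2 :=
  (Measurable.ite (measurableSet_eq_fun measurable_fst measurable_const) measurable_const
    measurable_const).sub ((measurable_posterior σsq a).comp measurable_snd)

/-- The only typicality statement that involves `V`, hence the only one that must hold against the
attack. -/
theorem negligible_forwarded_posterior (hσ : σsq ≠ 0) {a : ℝ} (ha : a = 1 ∨ a = -1) (t : ℝ)
    (hη : 0 < η) :
    Negligible (fun n => systemLaw σsq (κ n)) fun n =>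
      {ω | η ≤ |(∑ k, (if ω.2 k ≤ t then 1 else 0) *
        ((if ω.1.1 k = a then (1 : ℝ) else 0) - posterior σsq a (relayInput ω.1 k))) / n|} :=
  negligible_weighted_average (measurable_symbol_sub_posterior a)
    (fun p => abs_symbol_sub_posterior_le_one hσ ha p.1 p.2)
    (fun _ hh hh1 => integral_symbol_sub_posterior hσ ha hh hh1)
    (χ := fun v => if v ≤ t then 1 else 0)
    (Measurable.ite measurableSet_Iic measurable_const measurable_const)
    (fun v => by split_ifs <;> simp) hη

theorem negligible_received_posterior (hσ : σsq ≠ 0) {a : ℝ} (ha : a = 1 ∨ a = -1) (t : ℝ)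
    (hη : 0 < η) :
    Negligible (fun n => systemLaw σsq (κ n)) fun n =>
      {ω | η ≤ |(∑ k, (if relayInput ω.1 k ≤ t then 1 else 0) *
        ((if ω.1.1 k = a then (1 : ℝ) else 0) - posterior σsq a (relayInput ω.1 k))) / n|} := by
  have hm : Measurable fun u : ℝ => if u ≤ t then (1 : ℝ) else 0 :=
    Measurable.ite measurableSet_Iic measurable_const measurable_const
  have hb : ∀ u : ℝ, |if u ≤ t then (1 : ℝ) else 0| ≤ 1 := fun u => by split_ifs <;> simp
  have h := negligible_average_sub_integral (σsq := σsq) (κ := κ)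
    (g := fun p => (if p.2 ≤ t then 1 else 0) * ((if p.1 = a then 1 else 0) - posterior σsq a p.2))
    ((hm.comp measurable_snd).mul (measurable_symbol_sub_posterior a)) (C := 1)
    (fun p => by
      rw [abs_mul]
      exact mul_le_one₀ (hb _) (abs_nonneg _) (abs_symbol_sub_posterior_le_one hσ ha p.1 p.2)) hη
  rw [integral_symbol_sub_posterior hσ ha hm hb] at h
  simp only [sub_zero] at h
  exact h

end Typical

/-! ### Detectability -/

section Detectability

variable {σsq : ℝ≥0} {G : QuantGrid} {m : ℕ}

/-- There are `m - 1` summands and the normalization is `m - 2`; their ratio is at most `2` for `m ≥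
3`. -/
theorem symbolStat_le (hm : 3 ≤ m) {n : ℕ} {x v : Fin n → ℝ} {a c : ℝ}
    (h : ∀ j ∈ Finset.Icc 1 (m - 1),
      |condEmpCDF x v (G.point m j) a - relayCDF σsq a (G.point m j)| ≤ c) :
    symbolStat σsq G m x v a ≤ 2 * c := by
  have hm3 : (3 : ℝ) ≤ m := by exact_mod_cast hm
  have hm2 : (0 : ℝ) < (m : ℝ) - 2 := by linarith
  have hc : 0 ≤ c := (abs_nonneg _).trans (h 1 (Finset.mem_Icc.2 ⟨le_rfl, by omega⟩))
  have hs := Finset.sum_le_sum h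
  rw [Finset.sum_const, Nat.card_Icc, nsmul_eq_mul, Nat.sub_add_cancel (by omega),
    Nat.cast_sub (by omega), Nat.cast_one] at hs
  rw [symbolStat, one_div, inv_mul_le_iff₀ hm2]
  nlinarith

/-- One summand is bounded by the whole sum. The lost factor `m` is harmless because the threshold
may depend on `m`. -/
theorem abs_condEmpCDF_sub_le_of_symbolStat_le (hm : 3 ≤ m) {n : ℕ} {x v : Fin n → ℝ} {a θ : ℝ}
    (h : symbolStat σsq G m x v a ≤ θ) {j : ℕ} (hj : j ∈ Finset.Icc 1 (m - 1)) :
    |condEmpCDF x v (G.point m j) a - relayCDF σsq a (G.point m j)| ≤ m * θ := by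
  have hm3 : (3 : ℝ) ≤ m := by exact_mod_cast hm
  have hm2 : (0 : ℝ) < (m : ℝ) - 2 := by linarith
  have hle := Finset.single_le_sum (f := fun j =>
    |condEmpCDF x v (G.point m j) a - relayCDF σsq a (G.point m j)|)
    (fun _ _ => abs_nonneg _) hj
  rw [symbolStat, one_div, inv_mul_le_iff₀ hm2] at h
  have h0 := (abs_nonneg _).trans hle
  have hθ : 0 ≤ θ := by
    by_contra! hneg
    have := mul_neg_of_pos_of_neg hm2 hneg
    linarith
  calc _ ≤ _ := hle
    _ ≤ (m - 2) * θ := h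
    _ ≤ m * θ := by gcongr; linarith

/-- Without an attack the statistic is small. -/
theorem negligible_unattacked_inter_alarm (hσ : σsq ≠ 0) (hm : 3 ≤ m) {δ : ℝ} (hδ : 0 < δ)
    (κ : (n : ℕ) → Kernel (Fin n → ℝ) (Fin n → ℝ)) [∀ n, IsMarkovKernel (κ n)] :
    Negligible (fun n => systemLaw σsq (κ n)) fun n =>
      unattackedEvent G m n δ ∩ alarmEvent σsq G m n (12 * δ) := by
  -- With `η ≤ δ/4` each grid point contributes at most `4 (δ + 2η) ≤ 6δ`, and `symbolStat_le`
  -- doubles this.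
  set η := min (1 / 4) (δ / 4) with hηdef
  have hη : 0 < η := by positivity
  have hη1 : η ≤ 1 / 4 := min_le_left _ _
  have hη2 : η ≤ δ / 4 := min_le_right _ _
  have hsign : ∀ a ∈ ({1, -1} : Finset ℝ), a = 1 ∨ a = -1 := fun a ha => by simpa using ha
  refine (Negligible.biUnion ({1, -1} : Finset ℝ) fun a ha =>
    (negligible_symbol_frequency (hsign a ha) hη).union (Negligible.biUnion
      (Finset.Icc 1 (m - 1)) fun j _ =>
        negligible_symbol_le_frequency hσ (hsign a ha) (G.point m j) hη)).mono ?_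
  rintro n ω ⟨hR, hD⟩
  by_contra hbad
  simp only [mem_iUnion, mem_union, mem_ofPred_eq, not_exists, not_or, not_le] at hbad
  have hstat : ∀ a ∈ ({1, -1} : Finset ℝ), symbolStat σsq G m ω.1.1 ω.2 a ≤ 2 * (6 * δ) := by
    intro a ha
    refine symbolStat_le hm fun j hj => ?_
    refine (abs_condEmpCDF_sub_le (δ := δ) hη1 (relayCDF_nonneg hσ _ _) (relayCDF_le_one hσ _ _)
      (hbad a ha).1.le ((hbad a ha).2 j hj).le ?_).trans (by linarith)
    exact (sum_abs_stepDiff_le_mul_attackMeasure hm hj _ _).trans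
      (mul_le_mul_of_nonneg_left hR (Nat.cast_nonneg n))
  have h1 := hstat 1 (by simp)
  have h2 := hstat (-1) (by simp)
  have hD' : 12 * δ < max _ _ := hD
  exact absurd (max_le h1 h2) (by linarith)

/-- An attack cannot keep the statistic small. -/
theorem exists_negligible_attacked_diff_alarm (hσ : σsq ≠ 0) (G : QuantGrid) (hm : 3 ≤ m) {δ : ℝ}
    (hδ : 0 < δ) : ∃ θ : ℝ, 0 < θ ∧
      ∀ (κ : (n : ℕ) → Kernel (Fin n → ℝ) (Fin n → ℝ)) [∀ n, IsMarkovKernel (κ n)],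
      Negligible (fun n => systemLaw σsq (κ n)) fun n =>
        attackedEvent G m n δ \ alarmEvent σsq G m n θ := by
  classical
  have hm0 : (0 : ℝ) < m := by exact_mod_cast (by omega : 0 < m)
  -- Half the smallest cell probability, so that empirical cell frequencies stay above `q` once `η ≤
  -- q`.
  obtain ⟨q, hq, hqcell⟩ : ∃ q : ℝ, 0 < q ∧ ∀ i ∈ Finset.Icc 1 m,
      2 * q ≤ (sampleLaw σsq).real (Prod.snd ⁻¹' G.cell m i) := by
    obtain ⟨i₀, hi₀, hmin⟩ := (Finset.Icc 1 m).exists_min_image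
      (fun i => (sampleLaw σsq).real (Prod.snd ⁻¹' G.cell m i))
      ⟨1, Finset.mem_Icc.2 ⟨le_rfl, by omega⟩⟩
    have hpos := sampleLaw_real_preimage_snd_pos hσ (G.measurableSet_cell (m := m) i₀)
      (G.volume_cell_ne_zero hm hi₀)
    exact ⟨_, half_pos hpos, fun i hi => by linarith [hmin i hi]⟩
  -- Solves `m² τ / q = δ`, the bound of `attackMeasure_le`.
  set τ := δ * q / (m * m) with hτdef
  have hτ : 0 < τ := by positivity
  obtain ⟨r, hrnear, hr⟩ : ∃ r : ℝ, (∀ j ∈ Finset.Icc 1 (m - 1), (sampleLaw σsq).real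
      {p | |posterior σsq 1 p.2 - posterior σsq 1 (G.point m j)| < r} < τ / 4) ∧ 0 < r :=
    (((Finset.eventually_all (Finset.Icc 1 (m - 1))).2 fun j _ =>
      eventually_sampleLaw_posterior_near_lt hσ (G.point m j) (by positivity)).and
      self_mem_nhdsWithin).exists
  -- The last two entries give `τ/4 + η ≤ τ/2` for the indices with posterior near that of `t`, and
  -- `(τr/4 + 4η)/r ≤ τ/2` for the others.
  set η := min (min (1 / 4) q) (min (τ / 4) (τ * r / 16)) with hηdef
  have hη : 0 < η := by positivity
  have hη1 : η ≤ 1 / 4 := (min_le_left _ _).trans (min_le_left _ _)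
  have hη2 : η ≤ q := (min_le_left _ _).trans (min_le_right _ _)
  have hη3 : η ≤ τ / 4 := (min_le_right _ _).trans (min_le_left _ _)
  have hη4 : η ≤ τ * r / 16 := (min_le_right _ _).trans (min_le_right _ _)
  -- The threshold is fixed before the attack; its factor `1/m` offsets the loss in passing to a
  -- single grid point.
  refine ⟨τ * r / 4 / m, by positivity, fun κ _ => ?_⟩
  have hsign : ∀ a ∈ ({1, -1} : Finset ℝ), a = 1 ∨ a = -1 := fun a ha => by simpa using ha
  refine (((Negligible.biUnion (Finset.Icc 1 m) fun i _ =>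
      negligible_cell_frequency (σsq := σsq) (κ := κ) G m i hη).union
    (Negligible.biUnion (Finset.Icc 1 (m - 1)) fun j _ =>
      negligible_posterior_near (G.point m j) r hη)).union
    (Negligible.biUnion ({1, -1} : Finset ℝ) fun a ha =>
      (negligible_symbol_frequency (hsign a ha) hη).union (Negligible.biUnion
        (Finset.Icc 1 (m - 1)) fun j _ =>
          ((negligible_symbol_le_frequency hσ (hsign a ha) (G.point m j) hη).union
          (negligible_forwarded_posterior hσ (hsign a ha) (G.point m j) hη)).union
          (negligible_received_posterior hσ (hsign a ha) (G.point m j) hη)))).mono ?_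
  rintro n ω ⟨hR, hD⟩
  by_contra hbad
  simp only [mem_iUnion, mem_union, mem_ofPred_eq, not_exists, not_or, not_le] at hbad
  obtain ⟨⟨hcell, hnear⟩, hsym⟩ := hbad
  have hD' : max (symbolStat σsq G m ω.1.1 ω.2 1) (symbolStat σsq G m ω.1.1 ω.2 (-1)) ≤
      τ * r / 4 / m := not_lt.1 hD
  have hstat : ∀ a : ℝ, a = 1 ∨ a = -1 → symbolStat σsq G m ω.1.1 ω.2 a ≤ τ * r / 4 / m := by
    rintro a (rfl | rfl)
    exacts [(le_max_left _ _).trans hD', (le_max_right _ _).trans hD']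
  have hdev : ∀ j ∈ Finset.Icc 1 (m - 1),
      (∑ k, |stepDiff (G.point m j) (relayInput ω.1 k) (ω.2 k)|) / n ≤ τ := by
    intro j hj
    have hw := sum_abs_stepDiff_mul_le hσ (u := relayInput ω.1) (v := ω.2) (t := G.point m j)
      (ζ := τ * r / 4 + 4 * η) (fun a ha => by
        have ha' : a ∈ ({1, -1} : Finset ℝ) := by simpa using ha
        have hs := abs_condEmpCDF_sub_le_of_symbolStat_le hm (hstat a ha) hj
        rw [mul_div_cancel₀ _ hm0.ne'] at hs
        exact abs_sum_stepDiff_mul_le hη1 (relayCDF_nonneg hσ _ _) (relayCDF_le_one hσ _ _)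
          (hsym a ha').1.le ((hsym a ha').2 j hj).1.1.le ((hsym a ha').2 j hj).1.2.le
          ((hsym a ha').2 j hj).2.le hs)
    have hn := (abs_lt.1 (hnear j hj)).2
    have hρ := hrnear j hj
    refine (sum_le_of_weighted_sum_le (ρ := τ / 2) (fun k => abs_nonneg _)
      (fun k => abs_stepDiff_le_one _ _ _) (fun k => abs_nonneg _) hr hw
      (by linarith)).trans ?_
    have : (τ * r / 4 + 4 * η) / r ≤ τ / 2 := by
      rw [div_le_iff₀ hr]
      linarith
    linarith
  have hfin := attackMeasure_le hm (relayInput ω.1) ω.2 hq (fun i hi => by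
    have := (abs_lt.1 (hcell i hi)).1
    linarith [hqcell i hi]) hdev
  have hval : (m : ℝ) * m * (τ / q) = δ := by
    rw [hτdef]
    field_simp
  rw [hval] at hfin
  exact absurd hfin (not_le.2 hR)

/-! ### Measurability of the conditioning events and conditional probabilities. -/

theorem measurable_attackMeasure (n : ℕ) :
    Measurable fun ω : Source n × (Fin n → ℝ) => attackMeasure G m (relayInput ω.1) ω.2 := by
  have hu : ∀ k, Measurable fun ω : Source n × (Fin n → ℝ) => relayInput ω.1 k := fun k =>
    (measurable_pi_apply k).comp (measurable_relayInput.comp measurable_fst)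
  have hv : ∀ k, Measurable fun ω : Source n × (Fin n → ℝ) => ω.2 k := fun k => by fun_prop
  have hcell : ∀ i k, MeasurableSet {ω : Source n × (Fin n → ℝ) | relayInput ω.1 k ∈ G.cell m i} :=
    fun i k => hu k (G.measurableSet_cell i)
  unfold attackMeasure
  refine Finset.measurable_fun_sum _ fun j _ => Finset.measurable_fun_sum _ fun i _ => ?_
  refine Measurable.abs (Measurable.sub_const ?_ _)
  simp_rw [quantEmpCDF_eq]
  refine Measurable.div (Finset.measurable_fun_sum _ fun k _ => ?_)
    (Finset.measurable_fun_sum _ fun k _ => ?_)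
  · exact Measurable.ite ((measurableSet_le (hv k) measurable_const).inter (hcell i k))
      measurable_const measurable_const
  · exact Measurable.ite (hcell i k) measurable_const measurable_const

theorem measurableSet_attackedEvent (n : ℕ) (δ : ℝ) : MeasurableSet (attackedEvent G m n δ) :=
  measurableSet_lt measurable_const (measurable_attackMeasure n)

theorem measurableSet_unattackedEvent (n : ℕ) (δ : ℝ) : MeasurableSet (unattackedEvent G m n δ) :=
  measurableSet_le (measurable_attackMeasure n) measurable_const

/-- An event that is unlikely jointly with a likely one is unlikely given the latter. -/
theorem cond_real_le {Ω : Type*} [MeasurableSpace Ω] (μ : Measure Ω) [IsProbabilityMeasure μ]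
    {s t : Set Ω} (hs : MeasurableSet s) {c ε : ℝ} (hc : 0 < c) (hcs : c ≤ μ.real s)
    (h : μ.real (s ∩ t) ≤ ε * c) : (μ[|s]).real t ≤ ε := by
  have hε : 0 ≤ ε := nonneg_of_mul_nonneg_left (measureReal_nonneg.trans h) hc
  rw [measureReal_def, cond_apply hs, ENNReal.toReal_mul, ENNReal.toReal_inv]
  change (μ.real s)⁻¹ * μ.real (s ∩ t) ≤ ε
  rw [inv_mul_le_iff₀ (hc.trans_le hcs), mul_comm]
  exact h.trans (mul_le_mul_of_nonneg_left hcs hε)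

theorem one_sub_le_cond_real {Ω : Type*} [MeasurableSpace Ω] (μ : Measure Ω)
    [IsProbabilityMeasure μ] {s t : Set Ω} (hs : MeasurableSet s) {c ε : ℝ} (hc : 0 < c)
    (hcs : c ≤ μ.real s) (h : μ.real (s \ t) ≤ ε * c) : 1 - ε ≤ (μ[|s]).real t := by
  have hne : μ s ≠ 0 := fun h0 => by
    rw [measureReal_def, h0, ENNReal.toReal_zero] at hcs
    linarith
  have := cond_isProbabilityMeasure (μ := μ) hne
  have h1 := cond_real_le μ (t := tᶜ) hs hc hcs (by rwa [← sdiff_eq])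
  have h2 := measureReal_union_le (μ := μ[|s]) t tᶜ
  rw [union_compl_self, probReal_univ] at h2
  linarith

end Detectability

end

end TwoWayRelay

theorem theorem1 (σsq : ℝ≥0) (hσ : σsq ≠ 0) (G : ℕ → QuantGrid) (hG : IsAdmissible σsq G) :
    ∃ εth μth : ℕ → ℝ → ℝ,
      (∀ m : ℕ, ∀ δ : ℝ, 0 < δ → 0 < εth m δ) ∧
      Tendsto (fun p : ℕ × ℝ => μth p.1 p.2) (atTop ×ˢ 𝓝[>] (0 : ℝ)) (𝓝 0) ∧
      ∀ δ : ℝ, 0 < δ → ∀ ε : ℝ, 0 < ε → ∃ m₀ : ℕ, ∀ m : ℕ, m₀ ≤ m →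
        ∀ (κ : (n : ℕ) → Kernel (Fin n → ℝ) (Fin n → ℝ)) (_ : ∀ n, IsMarkovKernel (κ n)),
        ∀ c : ℝ, 0 < c →
          (∀ θ : ℝ, 0 < θ → θ ≤ εth m δ →
            ∀ᶠ n : ℕ in atTop,
              c ≤ (systemLaw σsq (κ n)).real (attackedEvent (G m) m n δ) →
              1 - ε ≤ ((systemLaw σsq (κ n))[|attackedEvent (G m) m n δ]).real
                (alarmEvent σsq (G m) m n θ)) ∧
          (∀ᶠ n : ℕ in atTop,
              c ≤ (systemLaw σsq (κ n)).real (unattackedEvent (G m) m n δ) →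
              ((systemLaw σsq (κ n))[|unattackedEvent (G m) m n δ]).real
                (alarmEvent σsq (G m) m n (μth m δ)) ≤ ε) := by
  have hex : ∀ (m : ℕ) (δ : ℝ), ∃ θ : ℝ, 0 < θ ∧ (3 ≤ m → 0 < δ →
      ∀ (κ : (n : ℕ) → Kernel (Fin n → ℝ) (Fin n → ℝ)) [∀ n, IsMarkovKernel (κ n)],
      Negligible (fun n => systemLaw σsq (κ n)) fun n =>
        attackedEvent (G m) m n δ \ alarmEvent σsq (G m) m n θ) := by
    intro m δ
    by_cases h : 3 ≤ m ∧ 0 < δ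
    · obtain ⟨θ, hθ, hneg⟩ := exists_negligible_attacked_diff_alarm hσ (G m) h.1 h.2
      exact ⟨θ, hθ, fun _ _ => hneg⟩
    -- A default value outside the relevant range keeps the threshold positive for all arguments.
    · exact ⟨1, one_pos, fun h1 h2 => absurd ⟨h1, h2⟩ h⟩
  choose εth hpos hneg using hex
  refine ⟨εth, fun _ δ => 12 * δ, fun m δ _ => hpos m δ, ?_, ?_⟩
  · have h : Tendsto (fun δ : ℝ => 12 * δ) (𝓝[>] 0) (𝓝 0) :=
      tendsto_nhdsWithin_of_tendsto_nhds (Continuous.tendsto' (by fun_prop) _ _ (by simp))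
    exact h.comp tendsto_snd
  · intro δ hδ ε hε
    refine ⟨3, fun m hm κ hκ c hc => ⟨fun θ _ hθ => ?_, ?_⟩⟩
    -- Lowering the threshold enlarges the alarm event, so every `θ` up to `εth m δ` is covered.
    · have hn : Negligible (fun n => systemLaw σsq (κ n)) fun n =>
          attackedEvent (G m) m n δ \ alarmEvent σsq (G m) m n θ :=
        (hneg m δ hm hδ κ).mono fun n => sdiff_subset_sdiff_right fun _ hω => lt_of_le_of_lt hθ hω
      filter_upwards [hn.eventually_le_const (mul_pos hε hc)] with n hn hcn
      exact one_sub_le_cond_real _ (measurableSet_attackedEvent n δ) hc hcn hn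
    · have hn := negligible_unattacked_inter_alarm (G := G m) hσ hm hδ κ
      filter_upwards [hn.eventually_le_const (mul_pos hε hc)] with n hn hcn
      exact cond_real_le _ (measurableSet_unattackedEvent n δ) hc hcn hn
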